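/- Let $H^2$ be the Hardy space of the open unit disc $\mathbb D$, identified through boundary values with the subspace of $L^2(\mathbb T)$ of functions whose Fourier coefficients of negative index vanish, let $P_+$ be the orthogonal projection of $L^2(\mathbb T)$ onto $H^2$, and for $v\in L^\infty(\mathbb T)$ let $T_v f=P_+(vf)$ $(f\in H^2)$ be the Toeplitz operator with symbol $v$. Let $b$ be a rational function without poles in $\overline{\mathbb D}$, with $\|b\|_\infty=1$, that is not inner (that is, $|b|=1$ does not hold almost everywhere on $\mathbb T$), and let $\mathscr H(b)=(I-T_bT_b^*)^{1/2}H^2$ be the associated de Branges–Rovnyak space, regarded as a space of analytic functions on $\mathbb D$. Let $\varphi:\mathbb D\to\mathbb D$ be analytic and let $u:\mathbb D\to\mathbb C$ be such that (H1) $u\in\mathscr H(b)$, and (H2) $u\varphi\in\mathscr H(b)$. Then: (a) for every polynomial $p\in\mathbb C[z]$, the function $u\cdot(p\circ\varphi)$ belongs to $\mathscr H(b)$; (b) more generally, for every polynomial $p\in\mathbb C[z]$, every integer $k\ge 0$, all $\lambda_1,\dots,\lambda_k\in\mathbb D$ and all integers $m_1,\dots,m_k\ge 0$, the function $$\frac{u\cdot(p\circ\varphi)}{\prod_{j=1}^k(1-\overline{\lambda_j}\,\varphi)^{m_j}}$$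 belongs to $\mathscr H(b)$. -/

import Mathlib

open MeasureTheory Polynomial AddCircle

namespace DeBrangesRovnyak

noncomputable section

/-- `L²(𝕋)`. The unit circle is modelled as `ℝ / ℤ` with its normalized Haar measure, the class of
`t` standing for the point `fourier 1 t = exp (2πit)`. -/
abbrev L2Circle : Type := Lp ℂ 2 (haarAddCircle (T := (1 : ℝ)))

/-- `L^∞(𝕋)`, with the essential supremum norm. -/
abbrev LInfCircle : Type := Lp ℂ ⊤ (haarAddCircle (T := (1 : ℝ)))

/-- The Hardy space `H²`, as the subspace of those functions in `L²(𝕋)` whose Fourier coefficients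
of negative index vanish. -/
def hardySpace : Submodule ℂ L2Circle where
  carrier := {f | ∀ n : ℤ, n < 0 → fourierCoeff f n = 0}
  zero_mem' := by
    intro n _
    rw [← fourierBasis_repr, map_zero]
    rfl
  add_mem' := by
    intro f g hf hg n hn
    have h1 := hf n hn
    have h2 := hg n hn
    rw [← fourierBasis_repr] at h1 h2 ⊢
    rw [map_add, lp.coeFn_add, Pi.add_apply, h1, h2, add_zero]
  smul_mem' := by
    intro c f hf n hn
    have h1 := hf n hn
    rw [← fourierBasis_repr] at h1 ⊢
    rw [map_smul, lp.coeFn_smul, Pi.smul_apply, h1, smul_zero]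

theorem mem_hardySpace {f : L2Circle} :
    f ∈ hardySpace ↔ ∀ n : ℤ, n < 0 → fourierCoeff f n = 0 := Iff.rfl

theorem isClosed_hardySpace : IsClosed (hardySpace : Set L2Circle) := by
  have h : (hardySpace : Set L2Circle) = ⋂ n : ℤ, ⋂ _ : n < 0,
      {f : L2Circle | inner ℂ (fourierBasis (T := (1 : ℝ)) n) f = 0} := by
    ext f
    simp only [SetLike.mem_coe, mem_hardySpace, Set.mem_iInter, Set.mem_ofPred_eq,
      ← fourierBasis_repr, HilbertBasis.repr_apply_apply]
  rw [h]
  exact isClosed_iInter fun n => isClosed_iInter fun _ =>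
    isClosed_eq (continuous_const.inner continuous_id) continuous_const

instance : CompleteSpace hardySpace := isClosed_hardySpace.completeSpace_coe

/-- The Toeplitz operator `T_v : H² → H²`, `f ↦ P₊ (v f)`, with symbol `v ∈ L^∞(𝕋)`, where `P₊` is
the orthogonal projection of `L²(𝕋)` onto `H²`. -/
def toeplitz (v : LInfCircle) : hardySpace →L[ℂ] hardySpace :=
  hardySpace.orthogonalProjectionOnto ∘L
    ((ContinuousLinearMap.mul ℂ ℂ).holderL (haarAddCircle (T := (1 : ℝ))) ⊤ 2 2 v) ∘L
    hardySpace.subtypeL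

/-- The defect operator `(I - T T^*)^{1/2}` of a contraction `T` of a Hilbert space; the root is the
unique positive square root of the positive operator `I - T T^*`. -/
def defectOperator {H : Type*} [NormedAddCommGroup H] [InnerProductSpace ℂ H] [CompleteSpace H]
    (T : H →L[ℂ] H) : H →L[ℂ] H :=
  CFC.sqrt (1 - T * ContinuousLinearMap.adjoint T)

/-- The de Branges–Rovnyak space `𝓗(b)`: the range of `(I - T_b T_b^*)^{1/2}` on `H²`, for a
function `b` in the closed unit ball of `H^∞` (so that `T_b` is a contraction). -/
def deBrangesRovnyak (b : LInfCircle) : Submodule ℂ hardySpace :=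
  LinearMap.range (defectOperator (toeplitz b)).toLinearMap

/-- The function `f`, looked at on the open unit disc only, belongs to `𝓗(b)`. As usual `F ∈ H²` is
identified with the analytic function `z ↦ ∑ F̂(n) zⁿ` on the disc. -/
def MemHb (b : LInfCircle) (f : ℂ → ℂ) : Prop :=
  ∃ F ∈ deBrangesRovnyak b, ∀ z ∈ Metric.ball (0 : ℂ) 1,
    HasSum (fun n : ℕ => fourierCoeff (F : L2Circle) (n : ℤ) * z ^ n) (f z)

/-- `b` is (the boundary function of) a rational function in `H^∞`, that is, of a rational function
without poles in the closed unit disc. -/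
def IsRationalHInfty (b : LInfCircle) : Prop :=
  ∃ P Q : ℂ[X], (∀ z ∈ Metric.closedBall (0 : ℂ) 1, Q.eval z ≠ 0) ∧
    ∀ᵐ t ∂(haarAddCircle (T := (1 : ℝ))),
      b t = P.eval (fourier 1 t : ℂ) / Q.eval (fourier 1 t : ℂ)

/-- `b` is unimodular almost everywhere on the circle; for `b` in `H^∞` this says that `b` is
inner. -/
def IsUnimodular (b : LInfCircle) : Prop :=
  ∀ᵐ t ∂(haarAddCircle (T := (1 : ℝ))), ‖b t‖ = 1

end

end DeBrangesRovnyak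

/-! Write `b = P/Q`. For such a symbol `𝓗(b)` is `p H² + ℂ[z]` for a polynomial `p` with all its
zeros on the circle (`exists_memHb_iff`), and the theorem becomes algebra in that space.

The description of `𝓗(b)` comes from duality: `F` is in the range of the self-adjoint defect
operator `S` iff `|⟨F, g⟩| ≤ C ‖S g‖` for all `g`. Since `‖S g‖² = ‖g‖² - ‖T_b^* g‖²`, the weight
`|Q|² - |P|²` governs `‖S g‖`. It is a nonzero nonnegative trigonometric polynomial, because `b` is
not inner, hence comparable on the circle to some `|p|²` (`exists_comparable_norm_sq`). This bounds
`‖p g‖` by `‖S g‖`, and `‖S (Q♯ g)‖` by `‖p g‖`, where `Q♯ = zⁿ conj Q` on the circle; each bound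
gives one inclusion.

The algebraic core is `MemAddPoly.mul_mul`: if `ψ` is bounded analytic and `u`, `uψ` are in `p H² +
ℂ[z]`, so is `uψ²`. With `u = pg + q` and `uψ = ph + r`, the polynomial `r` lies in `d H²` for `d =
gcd(p, q)`. A function in `H²` cannot have a pole on the circle, so `d ∣ r`, and Bézout turns `rψ`
into a combination of `qψ` and `pψ`. Taking `ψ = φ` and iterating gives (a); taking `ψ = (1 - conj λ
φ)⁻¹` and the starting function `u (1 - conj λ φ)` gives the divisions in (b). -/

namespace DeBrangesRovnyak

noncomputable section

/-! ### Multiplication operators and Fourier coefficients on the circle. -/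

/-- Multiplication of `L²(𝕋)` by a function in `L^∞(𝕋)`. -/
def mulL (v : LInfCircle) : L2Circle →L[ℂ] L2Circle :=
  (ContinuousLinearMap.mul ℂ ℂ).holderL (haarAddCircle (T := (1 : ℝ))) ⊤ 2 2 v

theorem coeFn_mulL (v : LInfCircle) (f : L2Circle) :
    mulL v f =ᵐ[haarAddCircle] fun t => v t * f t :=
  (ContinuousLinearMap.mul ℂ ℂ).coeFn_holder (r := 2) v f

theorem norm_mulL_le (v : LInfCircle) (f : L2Circle) : ‖mulL v f‖ ≤ ‖v‖ * ‖f‖ := by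
  have h := (ContinuousLinearMap.mul ℂ ℂ).norm_holder_apply_apply_le (r := 2) v f
  refine h.trans ?_
  gcongr
  nlinarith [ContinuousLinearMap.opNorm_mul_le ℂ ℂ, norm_nonneg v]

theorem fourierCoeff_eq_inner (f : L2Circle) (n : ℤ) :
    fourierCoeff f n = inner ℂ (fourierLp (T := (1 : ℝ)) 2 n) f := by
  rw [← fourierBasis_repr, HilbertBasis.repr_apply_apply, coe_fourierBasis]

theorem fourierCoeff_coe_add (f g : L2Circle) (n : ℤ) :
    fourierCoeff (f + g : L2Circle) n = fourierCoeff f n + fourierCoeff g n := by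
  simp only [fourierCoeff_eq_inner, inner_add_right]

theorem fourierCoeff_coe_smul (c : ℂ) (f : L2Circle) (n : ℤ) :
    fourierCoeff (c • f : L2Circle) n = c * fourierCoeff f n := by
  simp only [fourierCoeff_eq_inner, inner_smul_right]

theorem fourierCoeff_fourierLp (m n : ℤ) :
    fourierCoeff (fourierLp (T := (1 : ℝ)) 2 m) n = if n = m then 1 else 0 := by
  rw [fourierCoeff_eq_inner]
  exact orthonormal_iff_ite.1 (orthonormal_fourier (T := (1 : ℝ))) n m

theorem L2Circle.ext_fourierCoeff {f g : L2Circle}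
    (h : ∀ n : ℤ, fourierCoeff f n = fourierCoeff g n) : f = g := by
  apply (fourierBasis (T := (1 : ℝ))).repr.injective
  ext n
  simpa only [fourierBasis_repr] using h n

theorem hardySpace.ext_fourierCoeff {f g : hardySpace}
    (h : ∀ n : ℕ, fourierCoeff (f : L2Circle) (n : ℤ) = fourierCoeff (g : L2Circle) (n : ℤ)) :
    f = g := by
  refine Subtype.ext (L2Circle.ext_fourierCoeff fun n => ?_)
  rcases lt_or_ge n 0 with hn | hn
  · rw [f.2 n hn, g.2 n hn]
  · lift n to ℕ using hn
    exact h n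

theorem inner_eq_integral (f g : L2Circle) :
    inner ℂ f g = ∫ t, (starRingEnd ℂ) (f t) * g t ∂haarAddCircle := by
  rw [MeasureTheory.L2.inner_def]
  simp only [RCLike.inner_apply, mul_comm]

theorem norm_fourier_apply (n : ℤ) (t : AddCircle (1 : ℝ)) : ‖fourier n t‖ = 1 := by
  rw [fourier_apply]; exact Circle.norm_coe _

theorem fourierCoeff_mulL_fourier (f : L2Circle) (n : ℤ) :
    fourierCoeff (mulL (fourierLp (T := (1 : ℝ)) ⊤ 1) f) n = fourierCoeff f (n - 1) := by
  simp only [fourierCoeff]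
  apply integral_congr_ae
  filter_upwards [coeFn_mulL (fourierLp (T := (1 : ℝ)) ⊤ 1) f,
    coeFn_fourierLp (T := (1 : ℝ)) ⊤ 1] with t h1 h2
  rw [h1, h2, smul_eq_mul, smul_eq_mul, ← mul_assoc, ← fourier_add]
  congr 3; ring

/-! ### The shift and its polynomials, acting as analytic multipliers. -/

/-- Multiplication by `z` on the Hardy space. -/
def shift : hardySpace →L[ℂ] hardySpace :=
  (mulL (fourierLp (T := (1 : ℝ)) ⊤ 1) ∘L hardySpace.subtypeL).codRestrict hardySpace
    fun f n hn => by
    refine (fourierCoeff_mulL_fourier f n).trans (f.2 _ (by lia))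

theorem fourierCoeff_shift (f : hardySpace) (n : ℤ) :
    fourierCoeff (shift f : L2Circle) n = fourierCoeff (f : L2Circle) (n - 1) :=
  fourierCoeff_mulL_fourier f n

theorem coeFn_shift (f : hardySpace) :
    (shift f : L2Circle) =ᵐ[haarAddCircle] fun t => fourier 1 t * (f : L2Circle) t := by
  filter_upwards [coeFn_mulL (fourierLp (T := (1 : ℝ)) ⊤ 1) f,
    coeFn_fourierLp (T := (1 : ℝ)) ⊤ 1] with t h1 h2
  rw [← h2]; exact h1

/-- The constant function `1` in the Hardy space. -/
def hardyOne : hardySpace :=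
  ⟨fourierLp (T := (1 : ℝ)) 2 0, fun n hn => by rw [fourierCoeff_fourierLp, if_neg hn.ne]⟩

theorem fourierCoeff_hardyOne (n : ℤ) :
    fourierCoeff (hardyOne : L2Circle) n = if n = 0 then 1 else 0 :=
  fourierCoeff_fourierLp 0 n

theorem coeFn_aeval_shift (P : ℂ[X]) (f : hardySpace) :
    (aeval shift P f : L2Circle) =ᵐ[haarAddCircle]
      fun t => P.eval (fourier 1 t) * (f : L2Circle) t := by
  induction P using Polynomial.induction_on generalizing f with
  | C a =>
    simp only [aeval_C, eval_C]
    rw [Algebra.algebraMap_eq_smul_one]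
    exact Lp.coeFn_smul a (f : L2Circle)
  | add P Q hP hQ =>
    rw [map_add]
    have h := Lp.coeFn_add (aeval shift P f : L2Circle) (aeval shift Q f : L2Circle)
    filter_upwards [h, hP f, hQ f] with t h1 h2 h3
    rw [eval_add, add_mul, ← h2, ← h3]
    exact h1
  | monomial n a ih =>
    rw [pow_succ, ← mul_assoc, map_mul, aeval_X]
    filter_upwards [ih (shift f), coeFn_shift f] with t h1 h2
    rw [mul_apply_eq_comp, h1, h2, eval_mul (q := X), eval_X, mul_assoc]

theorem fourierCoeff_aeval_X_pow (k : ℕ) (f : hardySpace) (n : ℤ) :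
    fourierCoeff (aeval shift (X ^ k : ℂ[X]) f : L2Circle) n =
      fourierCoeff (f : L2Circle) (n - k) := by
  induction k generalizing n with
  | zero => simp
  | succ k ih =>
    rw [pow_succ', map_mul, aeval_X, mul_apply_eq_comp, fourierCoeff_shift, ih]
    congr 1; push_cast; ring

theorem fourierCoeff_aeval_hardyOne (P : ℂ[X]) (n : ℕ) :
    fourierCoeff (aeval shift P hardyOne : L2Circle) (n : ℤ) = P.coeff n := by
  induction P using Polynomial.induction_on' with
  | add P Q hP hQ =>
    rw [map_add, coeff_add, ← hP, ← hQ]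
    exact fourierCoeff_coe_add _ _ _
  | monomial k a =>
    rw [← C_mul_X_pow_eq_monomial, map_mul, aeval_C, Algebra.algebraMap_eq_smul_one,
      smul_mul_assoc, one_mul, coeff_C_mul_X_pow]
    refine (fourierCoeff_coe_smul a _ _).trans ?_
    refine (congrArg (a * ·) (fourierCoeff_aeval_X_pow k hardyOne n)).trans ?_
    rw [fourierCoeff_hardyOne]
    by_cases h : n = k
    · simp [h]
    · rw [if_neg h, if_neg (by lia), mul_zero]

theorem eq_aeval_hardyOne_of_fourierCoeff_eq_zero (f : hardySpace) (K : ℕ)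
    (h : ∀ n : ℕ, K ≤ n → fourierCoeff (f : L2Circle) (n : ℤ) = 0) :
    ∃ P : ℂ[X], f = aeval shift P hardyOne := by
  refine ⟨∑ i ∈ Finset.range K, monomial i (fourierCoeff (f : L2Circle) (i : ℤ)),
    hardySpace.ext_fourierCoeff fun n => ?_⟩
  rw [fourierCoeff_aeval_hardyOne]
  simp only [finsetSum_coeff, coeff_monomial, Finset.sum_ite_eq', Finset.mem_range]
  split_ifs with hn
  · rfl
  · exact h n (by lia)

theorem norm_aeval_shift_le {A B : ℂ[X]} {C : ℝ}
    (h : ∀ z : ℂ, ‖z‖ = 1 → ‖A.eval z‖ ≤ C * ‖B.eval z‖) (f : hardySpace) :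
    ‖aeval shift A f‖ ≤ C * ‖aeval shift B f‖ := by
  refine Lp.norm_le_mul_norm_of_ae_le_mul (f := (aeval shift A f : L2Circle))
    (g := (aeval shift B f : L2Circle)) ?_
  filter_upwards [coeFn_aeval_shift A f, coeFn_aeval_shift B f] with t h1 h2
  rw [h1, h2, norm_mul, norm_mul, ← mul_assoc]
  gcongr
  exact h _ (norm_fourier_apply 1 t)

/-- The inner product sees the multipliers only through `conj A · B` on the circle. This is how a
conjugate polynomial is traded for a reflected polynomial and a power of `z`. -/
theorem inner_aeval_shift_congr {A B A' B' : ℂ[X]}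
    (h : ∀ z : ℂ, ‖z‖ = 1 → (starRingEnd ℂ) (A.eval z) * B.eval z =
      (starRingEnd ℂ) (A'.eval z) * B'.eval z) (f g : hardySpace) :
    inner ℂ (aeval shift A f) (aeval shift B g) =
      inner ℂ (aeval shift A' f) (aeval shift B' g) := by
  simp only [Submodule.coe_inner, inner_eq_integral]
  apply integral_congr_ae
  filter_upwards [coeFn_aeval_shift A f, coeFn_aeval_shift B g, coeFn_aeval_shift A' f,
    coeFn_aeval_shift B' g] with t h1 h2 h3 h4
  rw [h1, h2, h3, h4, map_mul, map_mul]
  linear_combination ((starRingEnd ℂ) ((f : L2Circle) t) * (g : L2Circle) t) *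
    h _ (norm_fourier_apply 1 t)

/-- The polynomial that agrees with `zⁿ · conj P(z)` on the unit circle. -/
def conjReflect (n : ℕ) (P : ℂ[X]) : ℂ[X] := (P.reflect n).map (starRingEnd ℂ)

theorem conj_mul_self_of_norm_one {z : ℂ} (hz : ‖z‖ = 1) : (starRingEnd ℂ) z * z = 1 := by
  rw [Complex.conj_mul', hz]; norm_num

theorem eval_conjReflect {n : ℕ} {P : ℂ[X]} (hP : P.natDegree ≤ n) {z : ℂ} (hz : ‖z‖ = 1) :
    (conjReflect n P).eval z = (starRingEnd ℂ) (P.eval z) * z ^ n := by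
  have hzz := conj_mul_self_of_norm_one hz
  let _ : Invertible ((starRingEnd ℂ) z) := ⟨z, by rw [mul_comm, hzz], hzz⟩
  have h := eval₂_reflect_mul_pow (starRingEnd ℂ) ((starRingEnd ℂ) z) n P hP
  have hinv : ⅟((starRingEnd ℂ) z) = z := rfl
  rw [hinv, eval₂_hom] at h
  rw [conjReflect, eval_map, ← h, mul_assoc, ← mul_pow, hzz, one_pow, mul_one]

theorem norm_eval_conjReflect {n : ℕ} {P : ℂ[X]} (hP : P.natDegree ≤ n) {z : ℂ} (hz : ‖z‖ = 1) :
    ‖(conjReflect n P).eval z‖ = ‖P.eval z‖ := by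
  rw [eval_conjReflect hP hz, norm_mul, norm_pow, hz, one_pow, mul_one, RCLike.norm_conj]

/-! ### Ranges of self-adjoint operators by duality, and the defect operator. -/

/-- A functional dominated by `‖T ·‖` factors through `T`. -/
theorem exists_inner_eq_of_norm_le {E F : Type*} [NormedAddCommGroup E] [NormedSpace ℂ E]
    [NormedAddCommGroup F] [InnerProductSpace ℂ F] [CompleteSpace F]
    (l : E →ₗ[ℂ] ℂ) (T : E →ₗ[ℂ] F) {C : ℝ} (h : ∀ x, ‖l x‖ ≤ C * ‖T x‖) :
    ∃ k : F, ∀ x, l x = inner ℂ k (T x) := by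
  -- The bound makes `l` descend to a bounded functional on the range of `T`; Hahn–Banach extends it
  -- and Riesz represents it.
  obtain ⟨g, hg, -⟩ := exists_extension_norm_eq (LinearMap.range T) (l.compLeftInverse T)
  refine ⟨(InnerProductSpace.toDual ℂ F).symm g, fun x => ?_⟩
  rw [InnerProductSpace.toDual_symm_apply, hg ⟨T x, x, rfl⟩,
    LinearMap.compLeftInverse_apply_of_bdd _ _ ⟨C, h⟩ x _ rfl]

theorem mem_range_iff_norm_inner_le {H : Type*} [NormedAddCommGroup H] [InnerProductSpace ℂ H]
    [CompleteSpace H] {S : H →L[ℂ] H} (hS : IsSelfAdjoint S) (f : H) :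
    f ∈ LinearMap.range S.toLinearMap ↔ ∃ C : ℝ, ∀ g, ‖inner ℂ f g‖ ≤ C * ‖S g‖ := by
  have hsym : ∀ x y, inner ℂ (S x) y = inner ℂ x (S y) := fun x y => by
    rw [← ContinuousLinearMap.adjoint_inner_left, hS.adjoint_eq]
  constructor
  · rintro ⟨x, rfl⟩
    refine ⟨‖x‖, fun g => ?_⟩
    rw [ContinuousLinearMap.coe_coe, hsym]
    exact norm_inner_le_norm _ _
  · rintro ⟨C, hC⟩
    obtain ⟨k, hk⟩ := exists_inner_eq_of_norm_le (innerSL ℂ f).toLinearMap S.toLinearMap hC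
    refine ⟨k, ext_inner_right ℂ fun g => ?_⟩
    rw [ContinuousLinearMap.coe_coe, hsym]
    exact (hk g).symm

theorem inner_self_eq_ofReal {H : Type*} [NormedAddCommGroup H] [InnerProductSpace ℂ H] (x : H) :
    inner ℂ x x = ((‖x‖ ^ 2 : ℝ) : ℂ) := by
  rw [inner_self_eq_norm_sq_to_K, Complex.ofReal_pow]
  rfl

section DefectOperator

variable {H : Type*} [NormedAddCommGroup H] [InnerProductSpace ℂ H] [CompleteSpace H]

theorem isSelfAdjoint_defectOperator (T : H →L[ℂ] H) : IsSelfAdjoint (defectOperator T) :=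
  (CFC.sqrt_nonneg _).isSelfAdjoint

/-- The square of the defect operator is `1 - T T*`, so the identity is `⟨S² g, g⟩` computed twice.
Contractivity makes `1 - T T*` positive, without which the root would not square back. -/
theorem norm_sq_defectOperator {T : H →L[ℂ] H} (hT : ‖T‖ ≤ 1) (g : H) :
    ‖defectOperator T g‖ ^ 2 = ‖g‖ ^ 2 - ‖ContinuousLinearMap.adjoint T g‖ ^ 2 := by
  have key : ∀ g : H, inner ℂ ((1 - T * ContinuousLinearMap.adjoint T) g) g =
      ((‖g‖ ^ 2 - ‖ContinuousLinearMap.adjoint T g‖ ^ 2 : ℝ) : ℂ) := fun g => by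
    have h : inner ℂ (T (ContinuousLinearMap.adjoint T g)) g =
        ((‖ContinuousLinearMap.adjoint T g‖ ^ 2 : ℝ) : ℂ) := by
      rw [← ContinuousLinearMap.adjoint_inner_right, inner_self_eq_ofReal]
    rw [sub_apply, mul_apply_eq_comp, inner_sub_left, one_apply_eq_self, h, inner_self_eq_ofReal,
      Complex.ofReal_sub]
  have hnn : 0 ≤ 1 - T * ContinuousLinearMap.adjoint T := by
    rw [ContinuousLinearMap.nonneg_iff_isPositive, ContinuousLinearMap.isPositive_iff_complex]
    intro x
    have h1 : ‖ContinuousLinearMap.adjoint T x‖ ≤ ‖x‖ := by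
      simpa using (ContinuousLinearMap.adjoint T).le_of_opNorm_le
        ((LinearIsometryEquiv.norm_map _ T).le.trans hT) x
    rw [key]
    refine ⟨rfl, ?_⟩
    change 0 ≤ ‖x‖ ^ 2 - ‖ContinuousLinearMap.adjoint T x‖ ^ 2
    nlinarith [norm_nonneg (ContinuousLinearMap.adjoint T x)]
  have hsq : defectOperator T * defectOperator T = 1 - T * ContinuousLinearMap.adjoint T :=
    CFC.sqrt_mul_sqrt_self _ hnn
  have h := key g
  rw [← hsq, mul_apply_eq_comp, ← ContinuousLinearMap.adjoint_inner_right,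
    (isSelfAdjoint_defectOperator T).adjoint_eq, inner_self_eq_ofReal] at h
  exact Complex.ofReal_injective h

end DefectOperator

/-! ### Toeplitz operators, their adjoints, and norms as integrals. -/

theorem toeplitz_apply (v : LInfCircle) (f : hardySpace) :
    toeplitz v f = hardySpace.orthogonalProjectionOnto (mulL v f) := rfl

theorem norm_toeplitz_le (v : LInfCircle) : ‖toeplitz v‖ ≤ ‖v‖ :=
  ContinuousLinearMap.opNorm_le_bound _ (norm_nonneg _) fun f => by
    rw [toeplitz_apply]
    refine (Submodule.norm_orthogonalProjectionOnto_apply_le hardySpace _).trans ?_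
    exact norm_mulL_le v (f : L2Circle)

theorem adjoint_toeplitz_apply (v : LInfCircle) (f : hardySpace) :
    ContinuousLinearMap.adjoint (toeplitz v) f =
      hardySpace.orthogonalProjectionOnto (mulL (star v) f) := by
  refine ext_inner_right ℂ fun g => ?_
  rw [ContinuousLinearMap.adjoint_inner_left, toeplitz_apply,
    Submodule.inner_orthogonalProjectionOnto_eq_of_mem_left,
    Submodule.inner_orthogonalProjectionOnto_eq_of_mem_right, inner_eq_integral, inner_eq_integral]
  apply integral_congr_ae
  filter_upwards [coeFn_mulL v g, coeFn_mulL (star v) f, Lp.coeFn_star v] with t h1 h2 h3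
  rw [h1, h2, h3, map_mul, Pi.star_apply, RCLike.star_def, RCLike.conj_conj]
  ring

theorem norm_mulL_star (v : LInfCircle) (f : L2Circle) : ‖mulL (star v) f‖ = ‖mulL v f‖ := by
  have h : ∀ᵐ t ∂(haarAddCircle (T := (1 : ℝ))), ‖mulL (star v) f t‖ = ‖mulL v f t‖ := by
    filter_upwards [coeFn_mulL v f, coeFn_mulL (star v) f, Lp.coeFn_star v] with t h1 h2 h3
    rw [h1, h2, h3, norm_mul, norm_mul, Pi.star_apply, norm_star]
  exact le_antisymm (Lp.norm_le_norm_of_ae_le (h.mono fun _ => Eq.le))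
    (Lp.norm_le_norm_of_ae_le (h.mono fun _ => Eq.ge))

theorem norm_sq_eq_integral (f : L2Circle) : ‖f‖ ^ 2 = ∫ t, ‖f t‖ ^ 2 ∂haarAddCircle := by
  have h := inner_eq_integral f f
  rw [inner_self_eq_ofReal] at h
  simp only [Complex.conj_mul'] at h
  have h2 : (∫ t, ((‖f t‖ : ℂ)) ^ 2 ∂haarAddCircle) =
      ((∫ t, ‖f t‖ ^ 2 ∂haarAddCircle (T := (1 : ℝ)) : ℝ) : ℂ) := by
    rw [← integral_complex_ofReal]; push_cast; rfl
  rw [h2] at h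
  exact Complex.ofReal_injective h

theorem integrable_norm_sq (f : L2Circle) :
    Integrable (fun t => ‖f t‖ ^ 2) (haarAddCircle (T := (1 : ℝ))) :=
  (Lp.memLp f).integrable_norm_pow two_ne_zero

/-! ### Nonnegative trigonometric polynomials. -/

/-- If `z⁻ⁿ R(z) ≥ 0` on the unit circle then the zeros of `R` on the circle are not simple. -/
theorem derivative_eval_eq_zero_of_nonneg {R : ℂ[X]} {n : ℕ}
    (h : ∀ z : ℂ, ‖z‖ = 1 → 0 ≤ (R.eval z * (starRingEnd ℂ) z ^ n).re ∧
      (R.eval z * (starRingEnd ℂ) z ^ n).im = 0)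
    {ζ : ℂ} (hζ : ‖ζ‖ = 1) (hR : R.eval ζ = 0) : R.derivative.eval ζ = 0 := by
  -- `G` is `z⁻ⁿ R` along the circle through `ζ`, a nonnegative real function vanishing at `t = 0`.
  -- Its real part has a minimum there and its imaginary part is identically zero, so its derivative
  -- at `0` is zero.
  set G : ℝ → ℂ := fun t => R.eval (ζ * Complex.exp (t * Complex.I)) *
    ((starRingEnd ℂ) ζ * Complex.exp (-(t * Complex.I))) ^ n with hG
  have hG0 : G 0 = 0 := by simp [hG, hR]
  have hGK : ∀ t, 0 ≤ (G t).re ∧ (G t).im = 0 := fun t => by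
    have h1 := h (ζ * Complex.exp (t * Complex.I)) (by
      rw [norm_mul, hζ, Complex.norm_exp_ofReal_mul_I, one_mul])
    rw [map_mul, ← Complex.exp_conj] at h1
    simpa [hG] using h1
  have hlin : HasDerivAt (fun t : ℝ => (t : ℂ) * Complex.I) Complex.I 0 := by
    simpa using (Complex.ofRealCLM.hasDerivAt (x := (0 : ℝ))).mul_const Complex.I
  have he : HasDerivAt (fun t : ℝ => ζ * Complex.exp (t * Complex.I)) (ζ * Complex.I) 0 := by
    simpa using hlin.cexp.const_mul ζ
  have he' : DifferentiableAt ℝ (fun t : ℝ =>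
      ((starRingEnd ℂ) ζ * Complex.exp (-(t * Complex.I))) ^ n) 0 :=
    ((hlin.neg.cexp.const_mul _).differentiableAt).pow n
  have hp : HasDerivAt (fun t : ℝ => R.eval (ζ * Complex.exp (t * Complex.I)))
      (R.derivative.eval ζ * (ζ * Complex.I)) 0 := by
    have h1 : HasDerivAt (fun z => R.eval z) (R.derivative.eval ζ)
        ((fun t : ℝ => ζ * Complex.exp (t * Complex.I)) 0) := by
      simpa using R.hasDerivAt ζ
    exact HasDerivAt.comp (𝕜 := ℝ) (𝕜' := ℂ) (0 : ℝ) h1 he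
  have hGd : HasDerivAt G (R.derivative.eval ζ * (ζ * Complex.I) * (starRingEnd ℂ) ζ ^ n) 0 := by
    refine (hp.mul he'.hasDerivAt).congr_deriv ?_
    simp [hR]
  set D := R.derivative.eval ζ * (ζ * Complex.I) * (starRingEnd ℂ) ζ ^ n
  have hre : D.re = 0 := by
    have h1 : HasDerivAt (fun t => (G t).re) D.re 0 :=
      Complex.reCLM.hasFDerivAt.comp_hasDerivAt (0 : ℝ) hGd
    refine IsLocalMin.hasDerivAt_eq_zero (Filter.Eventually.of_forall fun t => ?_) h1
    simp only [hG0, Complex.zero_re, (hGK t).1]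
  have him : D.im = 0 := by
    have h1 : HasDerivAt (fun t => (G t).im) D.im 0 :=
      Complex.imCLM.hasFDerivAt.comp_hasDerivAt (0 : ℝ) hGd
    refine h1.unique ?_
    simp only [(hGK _).2]
    exact hasDerivAt_const _ _
  have hD : D = 0 := Complex.ext hre him
  have hζ0 : ζ ≠ 0 := fun h0 => by simp [h0] at hζ
  simpa [D, hζ0] using hD

/-- On the circle `(z - ζ)²` is a nonnegative number times `-ζ z`. A double zero can therefore be
replaced by the factor `-ζ z` without spoiling nonnegativity. -/
theorem sq_sub_eq_of_norm_one {z ζ : ℂ} (hz : ‖z‖ = 1) (hζ : ‖ζ‖ = 1) :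
    (z - ζ) ^ 2 = (‖z - ζ‖ ^ 2 : ℝ) * (-ζ * z) := by
  have h1 := conj_mul_self_of_norm_one hz
  have h2 := conj_mul_self_of_norm_one hζ
  rw [Complex.ofReal_pow, ← Complex.conj_mul', map_sub]
  linear_combination (ζ * z - ζ ^ 2) * h1 + (ζ * z - z ^ 2) * h2

theorem nonneg_of_sq_mul_nonneg {R : ℂ[X]} {n : ℕ} {ζ : ℂ} (hζ : ‖ζ‖ = 1)
    (h : ∀ z : ℂ, ‖z‖ = 1 →
      0 ≤ (((X - C ζ) * ((X - C ζ) * R)).eval z * (starRingEnd ℂ) z ^ n).re ∧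
      (((X - C ζ) * ((X - C ζ) * R)).eval z * (starRingEnd ℂ) z ^ n).im = 0)
    {z : ℂ} (hz : ‖z‖ = 1) :
      0 ≤ ((C (-ζ) * X * R).eval z * (starRingEnd ℂ) z ^ n).re ∧
      ((C (-ζ) * X * R).eval z * (starRingEnd ℂ) z ^ n).im = 0 := by
  set g : ℂ → ℂ := fun z => (C (-ζ) * X * R).eval z * (starRingEnd ℂ) z ^ n with hg
  have hne : ∀ w : ℂ, ‖w‖ = 1 → w ≠ ζ → 0 ≤ (g w).re ∧ (g w).im = 0 := fun w hw hwζ => by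
    have hpos : 0 < ‖w - ζ‖ ^ 2 := by
      have := norm_pos_iff.2 (sub_ne_zero.2 hwζ)
      positivity
    have heq : ((X - C ζ) * ((X - C ζ) * R)).eval w * (starRingEnd ℂ) w ^ n =
        (‖w - ζ‖ ^ 2 : ℝ) * g w := by
      simp only [hg, eval_mul, eval_sub, eval_X, eval_C]
      linear_combination (R.eval w * (starRingEnd ℂ) w ^ n) * sq_sub_eq_of_norm_one hw hζ
    have h1 := h w hw
    rw [heq, Complex.re_ofReal_mul, Complex.im_ofReal_mul] at h1
    exact ⟨nonneg_of_mul_nonneg_right h1.1 hpos, (mul_eq_zero.1 h1.2).resolve_left hpos.ne'⟩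
  by_cases hzζ : z = ζ
  · subst hzζ
    -- At `ζ` itself nothing can be divided out; nonnegativity is the limit of its values at nearby
    -- points of the circle.
    have hcl : IsClosed {w : ℂ | 0 ≤ w.re ∧ w.im = 0} :=
      (isClosed_le continuous_const Complex.continuous_re).inter
        (isClosed_eq Complex.continuous_im continuous_const)
    have hlin : HasDerivAt (fun t : ℝ => (t : ℂ) * Complex.I) Complex.I 0 := by
      simpa using (Complex.ofRealCLM.hasDerivAt (x := (0 : ℝ))).mul_const Complex.I
    have he : HasDerivAt (fun t : ℝ => z * Complex.exp (t * Complex.I)) (z * Complex.I) 0 := by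
      simpa using hlin.cexp.const_mul z
    have hz0 : z ≠ 0 := fun h0 => by simp [h0] at hz
    have hev := he.eventually_ne (c := z) (mul_ne_zero hz0 Complex.I_ne_zero)
    have hcont : Continuous fun t : ℝ => g (z * Complex.exp (t * Complex.I)) := by
      simp only [hg]
      fun_prop
    have ht := (hcont.tendsto 0).mono_left (nhdsWithin_le_nhds (s := {0}ᶜ))
    have hmem := hcl.mem_of_tendsto ht (hev.mono fun t ht' =>
      hne _ (by rw [norm_mul, hz, Complex.norm_exp_ofReal_mul_I, one_mul]) ht')
    change 0 ≤ (g z).re ∧ (g z).im = 0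
    simpa using hmem
  · exact hne z hz hzζ

/-- A substitute for the Fejér–Riesz theorem: a non-negative trigonometric polynomial is comparable
on the circle to the squared modulus of a polynomial all of whose zeros are on the circle. -/
theorem exists_comparable_norm_sq (R : ℂ[X]) (hR0 : R ≠ 0) (n : ℕ)
    (h : ∀ z : ℂ, ‖z‖ = 1 → 0 ≤ (R.eval z * (starRingEnd ℂ) z ^ n).re ∧
      (R.eval z * (starRingEnd ℂ) z ^ n).im = 0) :
    ∃ p : ℂ[X], p.Monic ∧ (∀ ζ, p.eval ζ = 0 → ‖ζ‖ = 1) ∧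
      ∃ c > 0, ∃ C > 0, ∀ z : ℂ, ‖z‖ = 1 →
        c * ‖p.eval z‖ ^ 2 ≤ ‖R.eval z‖ ∧ ‖R.eval z‖ ≤ C * ‖p.eval z‖ ^ 2 := by
  -- A zero `ζ` on the circle is at least double; replacing `(z - ζ)² R1` by `-ζ z R1` lowers the
  -- degree by one, and `p` gains a factor `z - ζ`. Zeros off the circle need no removal: once none
  -- is left on it, `|R|` lies between positive constants there and `p = 1` works.
  induction hd : R.natDegree using Nat.strong_induction_on generalizing R with
  | _ d ih =>
    by_cases hroot : ∃ ζ : ℂ, ‖ζ‖ = 1 ∧ R.eval ζ = 0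
    · obtain ⟨ζ, hζ, hRζ⟩ := hroot
      have hder := derivative_eval_eq_zero_of_nonneg h hζ hRζ
      obtain ⟨R0, rfl⟩ := dvd_iff_isRoot.2 hRζ
      have hR0ζ : R0.eval ζ = 0 := by simpa [derivative_mul] using hder
      obtain ⟨R1, rfl⟩ := dvd_iff_isRoot.2 hR0ζ
      have hζ0 : ζ ≠ 0 := fun h0 => by simp [h0] at hζ
      have hR1 : R1 ≠ 0 := by rintro rfl; simp at hR0
      have hX : (X - C ζ : ℂ[X]) ≠ 0 := X_sub_C_ne_zero ζ
      have hdeg : (C (-ζ) * X * R1).natDegree < d := by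
        rw [← hd, natDegree_mul hX (mul_ne_zero hX hR1), natDegree_mul hX hR1, natDegree_X_sub_C,
          mul_assoc, natDegree_C_mul (neg_ne_zero.2 hζ0), natDegree_mul X_ne_zero hR1, natDegree_X]
        lia
      obtain ⟨p, hp, hproots, c, hc, K, hK, hb⟩ := ih _ hdeg (C (-ζ) * X * R1)
        (mul_ne_zero (mul_ne_zero (by simpa using hζ0) X_ne_zero) hR1)
        (fun z hz => nonneg_of_sq_mul_nonneg hζ h hz) rfl
      refine ⟨(X - C ζ) * p, (monic_X_sub_C ζ).mul hp, fun w hw => ?_, c, hc, K, hK,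
        fun z hz => ?_⟩
      · rw [eval_mul, mul_eq_zero] at hw
        rcases hw with hw | hw
        · rw [eval_sub, eval_X, eval_C, sub_eq_zero] at hw
          rw [hw, hζ]
        · exact hproots w hw
      · have h1 : ‖(C (-ζ) * X * R1).eval z‖ = ‖R1.eval z‖ := by
          simp [hζ, hz]
        have h2 := hb z hz
        rw [h1] at h2
        simp only [eval_mul, eval_sub, eval_X, eval_C, norm_mul]
        have h3 := sq_nonneg ‖z - ζ‖
        constructor
        · nlinarith [mul_le_mul_of_nonneg_left h2.1 h3]
        · nlinarith [mul_le_mul_of_nonneg_left h2.2 h3]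
    · push Not at hroot
      have hcomp : IsCompact (Metric.sphere (0 : ℂ) 1) := isCompact_sphere 0 1
      have hcont : ContinuousOn (fun z => ‖R.eval z‖) (Metric.sphere (0 : ℂ) 1) := by fun_prop
      have hne : (Metric.sphere (0 : ℂ) 1).Nonempty := ⟨1, by simp⟩
      obtain ⟨z₁, hz₁, hmin⟩ := hcomp.exists_isMinOn hne hcont
      obtain ⟨z₂, hz₂, hmax⟩ := hcomp.exists_isMaxOn hne hcont
      refine ⟨1, monic_one, by simp, ‖R.eval z₁‖, ?_, ‖R.eval z₂‖, ?_, fun z hz => ?_⟩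
      · exact norm_pos_iff.2 (hroot z₁ (by simpa using hz₁))
      · exact norm_pos_iff.2 (hroot z₂ (by simpa using hz₂))
      · have hz' : z ∈ Metric.sphere (0 : ℂ) 1 := by simpa using hz
        simpa using ⟨isMinOn_iff.1 hmin z hz', isMaxOn_iff.1 hmax z hz'⟩

theorem ae_norm_le_norm (v : LInfCircle) : ∀ᵐ t ∂haarAddCircle, ‖v t‖ ≤ ‖v‖ := by
  filter_upwards [enorm_ae_le_eLpNormEssSup v haarAddCircle] with t ht
  rw [← eLpNorm_exponent_top, ← Lp.enorm_def] at ht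
  exact enorm_le_iff_norm_le.1 ht

/-- Haar measure charges every nonempty open set, so a set of full measure is dense, and a closed
condition passes to the closure. -/
theorem forall_of_ae_fourier {p : ℂ → Prop} (hp : IsClosed {z | p z})
    (h : ∀ᵐ t ∂(haarAddCircle (T := (1 : ℝ))), p (fourier 1 t)) {z : ℂ} (hz : ‖z‖ = 1) : p z := by
  have hcl : IsClosed {t : AddCircle (1 : ℝ) | p (fourier 1 t)} :=
    hp.preimage (fourier (T := (1 : ℝ)) 1).continuous
  have hall : ∀ t : AddCircle (1 : ℝ), p (fourier 1 t) := fun t => by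
    have := (Measure.dense_of_ae h) t
    rwa [hcl.closure_eq] at this
  obtain ⟨t, ht⟩ := (AddCircle.homeomorphCircle (T := 1) one_ne_zero).surjective
    ⟨z, mem_sphere_zero_iff_norm.2 hz⟩
  have h1 := hall t
  rw [fourier_one, ← homeomorphCircle_apply one_ne_zero, ht] at h1
  exact h1

/-! ### The two norm estimates for a rational symbol. -/

/-- The polynomial that agrees with `zⁿ (|Q|² - |P|²)` on the unit circle. -/
def defectPoly (n : ℕ) (P Q : ℂ[X]) : ℂ[X] := Q * conjReflect n Q - P * conjReflect n P

theorem eval_defectPoly {n : ℕ} {P Q : ℂ[X]} (hP : P.natDegree ≤ n) (hQ : Q.natDegree ≤ n)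
    {z : ℂ} (hz : ‖z‖ = 1) :
    (defectPoly n P Q).eval z = ((‖Q.eval z‖ ^ 2 - ‖P.eval z‖ ^ 2 : ℝ) : ℂ) * z ^ n := by
  rw [defectPoly, eval_sub, eval_mul, eval_mul, eval_conjReflect hP hz, eval_conjReflect hQ hz]
  push_cast
  rw [← Complex.mul_conj', ← Complex.mul_conj']
  ring

section RationalSymbol

variable {b : LInfCircle} {P Q : ℂ[X]} {n : ℕ}

theorem norm_eval_le_of_ae_eq (hb_norm : ‖b‖ = 1)
    (hQ0 : ∀ z ∈ Metric.closedBall (0 : ℂ) 1, Q.eval z ≠ 0)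
    (hb : ∀ᵐ t ∂(haarAddCircle (T := (1 : ℝ))),
      b t = P.eval (fourier 1 t : ℂ) / Q.eval (fourier 1 t : ℂ))
    {z : ℂ} (hz : ‖z‖ = 1) : ‖P.eval z‖ ≤ ‖Q.eval z‖ := by
  refine forall_of_ae_fourier (p := fun z => ‖P.eval z‖ ≤ ‖Q.eval z‖)
    (isClosed_le (by fun_prop) (by fun_prop)) ?_ hz
  filter_upwards [hb, ae_norm_le_norm b] with t h1 h2
  have hq := hQ0 (fourier 1 t) (mem_closedBall_zero_iff.2 (norm_fourier_apply 1 t).le)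
  rw [hb_norm, h1, norm_div, div_le_one (norm_pos_iff.2 hq)] at h2
  exact h2

theorem defectPoly_ne_zero (hP : P.natDegree ≤ n) (hQ : Q.natDegree ≤ n)
    (hQ0 : ∀ z ∈ Metric.closedBall (0 : ℂ) 1, Q.eval z ≠ 0)
    (hb : ∀ᵐ t ∂(haarAddCircle (T := (1 : ℝ))),
      b t = P.eval (fourier 1 t : ℂ) / Q.eval (fourier 1 t : ℂ))
    (hb_not_inner : ¬ IsUnimodular b) : defectPoly n P Q ≠ 0 := by
  intro h0
  refine hb_not_inner ?_
  filter_upwards [hb] with t h1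
  have hz := norm_fourier_apply 1 t
  have hq := norm_pos_iff.2 (hQ0 (fourier 1 t) (mem_closedBall_zero_iff.2 hz.le))
  have h2 := eval_defectPoly hP hQ hz
  rw [h0, eval_zero] at h2
  have h3 := (mul_eq_zero.1 h2.symm).resolve_right
    (pow_ne_zero n (norm_pos_iff.1 (by rw [hz]; norm_num)))
  have h4 : ‖Q.eval (fourier 1 t : ℂ)‖ ^ 2 - ‖P.eval (fourier 1 t : ℂ)‖ ^ 2 = 0 :=
    Complex.ofReal_injective h3
  rw [h1, norm_div, div_eq_one_iff_eq hq.ne']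
  nlinarith [norm_nonneg (P.eval (fourier 1 t : ℂ))]

theorem exists_comparable_defect (hb_norm : ‖b‖ = 1)
    (hQ0 : ∀ z ∈ Metric.closedBall (0 : ℂ) 1, Q.eval z ≠ 0)
    (hb : ∀ᵐ t ∂(haarAddCircle (T := (1 : ℝ))),
      b t = P.eval (fourier 1 t : ℂ) / Q.eval (fourier 1 t : ℂ))
    (hb_not_inner : ¬ IsUnimodular b) :
    ∃ p : ℂ[X], p.Monic ∧ (∀ ζ, p.eval ζ = 0 → ‖ζ‖ = 1) ∧
      ∃ c > 0, ∃ C > 0, ∀ z : ℂ, ‖z‖ = 1 →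
        c * ‖p.eval z‖ ^ 2 ≤ ‖Q.eval z‖ ^ 2 - ‖P.eval z‖ ^ 2 ∧
        ‖Q.eval z‖ ^ 2 - ‖P.eval z‖ ^ 2 ≤ C * ‖p.eval z‖ ^ 2 := by
  set n := max P.natDegree Q.natDegree
  have hP : P.natDegree ≤ n := le_max_left _ _
  have hQ : Q.natDegree ≤ n := le_max_right _ _
  have hnn : ∀ z : ℂ, ‖z‖ = 1 → 0 ≤ ‖Q.eval z‖ ^ 2 - ‖P.eval z‖ ^ 2 := fun z hz =>
    sub_nonneg.2 (pow_le_pow_left₀ (norm_nonneg _) (norm_eval_le_of_ae_eq hb_norm hQ0 hb hz) 2)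
  obtain ⟨p, hp, hroots, c, hc, C, hC, h⟩ := exists_comparable_norm_sq (defectPoly n P Q)
    (defectPoly_ne_zero hP hQ hQ0 hb hb_not_inner) n fun z hz => by
      rw [eval_defectPoly hP hQ hz, mul_assoc, ← mul_pow, mul_comm z,
        conj_mul_self_of_norm_one hz, one_pow, mul_one, Complex.ofReal_re, Complex.ofReal_im]
      exact ⟨hnn z hz, rfl⟩
  refine ⟨p, hp, hroots, c, hc, C, hC, fun z hz => ?_⟩
  have h1 := h z hz
  rwa [eval_defectPoly hP hQ hz, norm_mul, norm_pow, hz, one_pow, mul_one, Complex.norm_real,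
    Real.norm_of_nonneg (hnn z hz)] at h1

/-- Dropping the projection in `T_b^*` only increases the norm, so `‖S g‖²` is at least the integral
of `(1 - |b|²)|g|²`. Pointwise `|p|² ≤ (M²/c)(1 - |b|²)`, where `M` bounds `|Q|` on the circle. -/
theorem norm_aeval_shift_le_norm_defectOperator (hb_norm : ‖b‖ = 1)
    (hQ0 : ∀ z ∈ Metric.closedBall (0 : ℂ) 1, Q.eval z ≠ 0)
    (hb : ∀ᵐ t ∂(haarAddCircle (T := (1 : ℝ))),
      b t = P.eval (fourier 1 t : ℂ) / Q.eval (fourier 1 t : ℂ))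
    {p : ℂ[X]} {c : ℝ} (hc : 0 < c)
    (h : ∀ z : ℂ, ‖z‖ = 1 → c * ‖p.eval z‖ ^ 2 ≤ ‖Q.eval z‖ ^ 2 - ‖P.eval z‖ ^ 2) :
    ∃ C : ℝ, 0 ≤ C ∧ ∀ g, ‖aeval shift p g‖ ≤ C * ‖defectOperator (toeplitz b) g‖ := by
  obtain ⟨M, hM⟩ := (isCompact_sphere (0 : ℂ) 1).exists_bound_of_continuousOn
    (f := fun z => Q.eval z) (by fun_prop)
  have hK : 0 ≤ M ^ 2 / c := by positivity
  refine ⟨√(M ^ 2 / c), Real.sqrt_nonneg _, fun g => ?_⟩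
  have hmul : ‖ContinuousLinearMap.adjoint (toeplitz b) g‖ ≤ ‖mulL b (g : L2Circle)‖ := by
    rw [adjoint_toeplitz_apply, ← norm_mulL_star]
    exact Submodule.norm_orthogonalProjectionOnto_apply_le _ _
  have hint : ‖(aeval shift p g : L2Circle)‖ ^ 2 ≤
      M ^ 2 / c * (‖(g : L2Circle)‖ ^ 2 - ‖mulL b (g : L2Circle)‖ ^ 2) := by
    rw [norm_sq_eq_integral, norm_sq_eq_integral, norm_sq_eq_integral,
      ← integral_sub (integrable_norm_sq _) (integrable_norm_sq _), ← integral_const_mul]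
    refine integral_mono_ae (integrable_norm_sq _)
      (((integrable_norm_sq _).sub (integrable_norm_sq _)).const_mul _) ?_
    filter_upwards [hb, coeFn_aeval_shift p g, coeFn_mulL b g] with t h1 h2 h3
    have hz := norm_fourier_apply 1 t
    set z : ℂ := fourier 1 t
    have hq := norm_pos_iff.2 (hQ0 z (by simp [hz]))
    have hqM : ‖Q.eval z‖ ≤ M := hM z (by simp [hz])
    have hpz := h z hz
    have hPQ : ‖P.eval z‖ = ‖b t‖ * ‖Q.eval z‖ := by
      rw [h1, norm_div, div_mul_cancel₀ _ hq.ne']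
    simp only [h2, h3, norm_mul]
    rw [hPQ] at hpz
    have hb0 : 0 ≤ 1 - ‖b t‖ ^ 2 := by
      have h0 : 0 ≤ ‖Q.eval z‖ ^ 2 * (1 - ‖b t‖ ^ 2) := by
        nlinarith [mul_nonneg hc.le (sq_nonneg ‖p.eval z‖)]
      exact nonneg_of_mul_nonneg_right h0 (by positivity)
    have h4 : c * ‖p.eval z‖ ^ 2 ≤ M ^ 2 * (1 - ‖b t‖ ^ 2) := by
      have : ‖Q.eval z‖ ^ 2 ≤ M ^ 2 := pow_le_pow_left₀ hq.le hqM 2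
      nlinarith
    have h5 : ‖p.eval z‖ ^ 2 ≤ M ^ 2 / c * (1 - ‖b t‖ ^ 2) := by
      rw [div_mul_eq_mul_div, le_div_iff₀ hc]
      linarith
    nlinarith [mul_le_mul_of_nonneg_right h5 (sq_nonneg ‖(g : L2Circle) t‖)]
  have hS := norm_sq_defectOperator ((norm_toeplitz_le b).trans hb_norm.le) g
  have hsq : ‖aeval shift p g‖ ^ 2 ≤ (√(M ^ 2 / c) * ‖defectOperator (toeplitz b) g‖) ^ 2 := by
    rw [mul_pow, Real.sq_sqrt hK, hS]
    refine hint.trans (mul_le_mul_of_nonneg_left ?_ hK)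
    exact sub_le_sub_left (pow_le_pow_left₀ (norm_nonneg _) hmul 2) _
  exact le_of_sq_le_sq hsq (by positivity)

/-- On the circle `conj b · Q♯ = P♯`, which is again analytic. On `Q♯ H²` the projection in `T_b^*`
thus loses nothing, and `‖S (Q♯ g)‖²` is exactly the integral of `(|Q|² - |P|²)|g|²`. -/
theorem norm_defectOperator_conjReflect_le (hb_norm : ‖b‖ = 1)
    (hQ0 : ∀ z ∈ Metric.closedBall (0 : ℂ) 1, Q.eval z ≠ 0)
    (hb : ∀ᵐ t ∂(haarAddCircle (T := (1 : ℝ))),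
      b t = P.eval (fourier 1 t : ℂ) / Q.eval (fourier 1 t : ℂ))
    (hP : P.natDegree ≤ n) (hQ : Q.natDegree ≤ n) {p : ℂ[X]} {C : ℝ} (hC : 0 < C)
    (h : ∀ z : ℂ, ‖z‖ = 1 → ‖Q.eval z‖ ^ 2 - ‖P.eval z‖ ^ 2 ≤ C * ‖p.eval z‖ ^ 2)
    (g : hardySpace) :
    ‖defectOperator (toeplitz b) (aeval shift (conjReflect n Q) g)‖ ≤
      √C * ‖aeval shift p g‖ := by
  have hadj : ContinuousLinearMap.adjoint (toeplitz b) (aeval shift (conjReflect n Q) g) =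
      aeval shift (conjReflect n P) g := by
    have hmul : mulL (star b) (aeval shift (conjReflect n Q) g : hardySpace) =
        (aeval shift (conjReflect n P) g : hardySpace) := by
      refine Lp.ext ?_
      filter_upwards [hb, coeFn_aeval_shift (conjReflect n Q) g,
        coeFn_aeval_shift (conjReflect n P) g, Lp.coeFn_star b,
        coeFn_mulL (star b) (aeval shift (conjReflect n Q) g : hardySpace)] with t h1 h2 h3 h4 h5
      have hz := norm_fourier_apply 1 t
      have hq := hQ0 (fourier 1 t) (mem_closedBall_zero_iff.2 hz.le)
      rw [h5, h4, h2, h3, Pi.star_apply, h1, eval_conjReflect hP hz, eval_conjReflect hQ hz,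
        RCLike.star_def, map_div₀]
      have hq' : (starRingEnd ℂ) (Q.eval (fourier 1 t : ℂ)) ≠ 0 := by simpa using hq
      field_simp
    rw [adjoint_toeplitz_apply, hmul, Submodule.orthogonalProjectionOnto_mem_subspace_eq_self]
  have hint : ‖(aeval shift (conjReflect n Q) g : L2Circle)‖ ^ 2 -
      ‖(aeval shift (conjReflect n P) g : L2Circle)‖ ^ 2 ≤
        C * ‖(aeval shift p g : L2Circle)‖ ^ 2 := by
    rw [norm_sq_eq_integral, norm_sq_eq_integral, norm_sq_eq_integral,
      ← integral_sub (integrable_norm_sq _) (integrable_norm_sq _), ← integral_const_mul]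
    refine integral_mono_ae ((integrable_norm_sq _).sub (integrable_norm_sq _))
      ((integrable_norm_sq _).const_mul _) ?_
    filter_upwards [coeFn_aeval_shift (conjReflect n Q) g,
        coeFn_aeval_shift (conjReflect n P) g, coeFn_aeval_shift p g] with t h1 h2 h3
    have hz := norm_fourier_apply 1 t
    simp only [h1, h2, h3, norm_mul, norm_eval_conjReflect hP hz,
      norm_eval_conjReflect hQ hz]
    nlinarith [mul_le_mul_of_nonneg_right (h _ hz) (sq_nonneg ‖(g : L2Circle) t‖)]
  refine le_of_sq_le_sq ?_ (by positivity)
  rw [norm_sq_defectOperator ((norm_toeplitz_le b).trans hb_norm.le), hadj, mul_pow,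
    Real.sq_sqrt hC.le]
  exact hint

end RationalSymbol

/-! ### The range of the defect operator as `p H² + ℂ[z]`. -/

theorem coe_aeval_X_pow_hardyOne (m : ℕ) :
    ((aeval shift (X ^ m : ℂ[X]) hardyOne : hardySpace) : L2Circle) =
      fourierLp (T := (1 : ℝ)) 2 (m : ℤ) := by
  refine L2Circle.ext_fourierCoeff fun n => ?_
  rw [fourierCoeff_aeval_X_pow, fourierCoeff_hardyOne, fourierCoeff_fourierLp]
  simp only [sub_eq_zero]

theorem inner_aeval_X_pow_hardyOne (m : ℕ) (f : hardySpace) :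
    inner ℂ (aeval shift (X ^ m : ℂ[X]) hardyOne) f = fourierCoeff (f : L2Circle) (m : ℤ) := by
  rw [Submodule.coe_inner, coe_aeval_X_pow_hardyOne, fourierCoeff_eq_inner]

theorem inner_aeval_hardyOne_aeval_X_pow {t : ℂ[X]} {N : ℕ} (ht : t.degree < N) (g : hardySpace) :
    inner ℂ (aeval shift t hardyOne) (aeval shift (X ^ N : ℂ[X]) g) = 0 := by
  rw [t.as_sum_support_C_mul_X_pow, map_sum, sum_apply, sum_inner]
  refine Finset.sum_eq_zero fun i hi => ?_
  have hiN : i < N := by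
    have := (le_degree_of_mem_supp i hi).trans_lt ht
    exact_mod_cast this
  rw [map_mul, aeval_C, Algebra.algebraMap_eq_smul_one, smul_mul_assoc, one_mul,
    smul_apply, inner_smul_left, inner_aeval_X_pow_hardyOne,
    fourierCoeff_aeval_X_pow, g.2 _ (by lia), mul_zero]

theorem aeval_mul_apply (A B : ℂ[X]) (f : hardySpace) :
    aeval shift (A * B) f = aeval shift A (aeval shift B f) := by
  rw [map_mul, mul_apply_eq_comp]

section Characterization

variable {p Q : ℂ[X]} {S : hardySpace →L[ℂ] hardySpace}

/-- By duality `⟨F, Q♯ g⟩ = ⟨k, p♯ g⟩` for some `k`. Undoing the reflections, `z^N Q F - p zⁿ k` is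
orthogonal to `z^(N+n) H²`, hence is a polynomial. Since `z^N Q` has no zero on the circle it is
coprime to `p`, and Bézout solves for `F` modulo `p H²`. -/
theorem exists_decomposition_of_mem_range (hS : IsSelfAdjoint S)
    (hp : ∀ ζ, p.eval ζ = 0 → ‖ζ‖ = 1)
    (hQ0 : ∀ z ∈ Metric.closedBall (0 : ℂ) 1, Q.eval z ≠ 0) {n : ℕ} (hQ : Q.natDegree ≤ n)
    {C : ℝ} (hC : 0 ≤ C)
    (hb : ∀ g, ‖S (aeval shift (conjReflect n Q) g)‖ ≤ C * ‖aeval shift p g‖)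
    {F : hardySpace} (hF : F ∈ LinearMap.range S.toLinearMap) :
    ∃ (h : hardySpace) (q : ℂ[X]), F = aeval shift p h + aeval shift q hardyOne := by
  obtain ⟨C₀, hC₀⟩ := (mem_range_iff_norm_inner_le hS F).1 hF
  set N := p.natDegree
  have hnorm : ∀ g : hardySpace, ‖aeval shift p g‖ ≤ 1 * ‖aeval shift (conjReflect N p) g‖ :=
    norm_aeval_shift_le fun z hz => by rw [norm_eval_conjReflect le_rfl hz, one_mul]
  obtain ⟨k, hk⟩ := exists_inner_eq_of_norm_le
    (innerSL ℂ F ∘L aeval shift (conjReflect n Q)).toLinearMap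
    (aeval shift (conjReflect N p)).toLinearMap (C := |C₀| * C) fun g => by
      calc ‖inner ℂ F (aeval shift (conjReflect n Q) g)‖
          ≤ C₀ * ‖S (aeval shift (conjReflect n Q) g)‖ := hC₀ _
        _ ≤ |C₀| * (C * ‖aeval shift p g‖) :=
            mul_le_mul (le_abs_self _) (hb g) (norm_nonneg _) (abs_nonneg _)
        _ ≤ |C₀| * (C * ‖aeval shift (conjReflect N p) g‖) := by
            gcongr
            simpa using hnorm g
        _ = |C₀| * C * ‖aeval shift (conjReflect N p) g‖ := (mul_assoc _ _ _).symm
  replace hk : ∀ g, inner ℂ F (aeval shift (conjReflect n Q) g) =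
      inner ℂ k (aeval shift (conjReflect N p) g) := hk
  have hV : ∀ g : hardySpace,
      inner ℂ (aeval shift (X ^ N * Q) F - aeval shift (p * X ^ n) k)
        (aeval shift (X ^ (N + n) : ℂ[X]) g) = 0 := fun g => by
    have h1 := inner_aeval_shift_congr (A := X ^ N * Q) (B := X ^ (N + n)) (A' := 1)
      (B' := conjReflect n Q) (fun z hz => by
        rw [eval_conjReflect hQ hz]
        simp only [eval_mul, eval_pow, eval_X, eval_one, map_mul, map_pow, map_one]
        have := congrArg (· ^ N) (conj_mul_self_of_norm_one hz)
        simp only [mul_pow, one_pow] at this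
        linear_combination (starRingEnd ℂ) (Q.eval z) * z ^ n * this) F g
    have h2 := inner_aeval_shift_congr (A := p * X ^ n) (B := X ^ (N + n)) (A' := 1)
      (B' := conjReflect N p) (fun z hz => by
        rw [eval_conjReflect le_rfl hz]
        simp only [eval_mul, eval_pow, eval_X, eval_one, map_mul, map_pow, map_one]
        have := congrArg (· ^ n) (conj_mul_self_of_norm_one hz)
        simp only [mul_pow, one_pow] at this
        linear_combination (starRingEnd ℂ) (p.eval z) * z ^ N * this) k g
    rw [inner_sub_left, h1, h2, map_one, one_apply_eq_self, one_apply_eq_self, hk, sub_self]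
  obtain ⟨t, ht⟩ := eq_aeval_hardyOne_of_fourierCoeff_eq_zero
    (aeval shift (X ^ N * Q) F - aeval shift (p * X ^ n) k) (N + n) fun m hm => by
      obtain ⟨j, rfl⟩ := Nat.exists_eq_add_of_le hm
      rw [← inner_aeval_X_pow_hardyOne, pow_add, aeval_mul_apply]
      exact (inner_eq_zero_symm (𝕜 := ℂ) (E := hardySpace)).1 (hV _)
  have hcop : IsCoprime (X ^ N * Q) p := by
    refine (isCoprime_iff_aeval_ne_zero_of_isAlgClosed ℂ ℂ _ _).2 fun z => ?_
    simp only [coe_aeval_eq_eval]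
    by_contra! hz
    have hz1 := hp z hz.2
    have h0 : z ≠ 0 := fun h0 => by simp [h0] at hz1
    have hq := hQ0 z (mem_closedBall_zero_iff.2 hz1.le)
    simp [h0, hq] at hz
  obtain ⟨α, β, hαβ⟩ := hcop
  refine ⟨aeval shift (α * X ^ n) k + aeval shift β F, α * t, ?_⟩
  calc F = aeval shift (α * (X ^ N * Q) + β * p) F := by rw [hαβ, map_one, one_apply_eq_self]
    _ = aeval shift α (aeval shift (X ^ N * Q) F) + aeval shift (p * β) F := by
      rw [map_add, add_apply, aeval_mul_apply, mul_comm β]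
    _ = aeval shift α (aeval shift (p * X ^ n) k + aeval shift t hardyOne) +
        aeval shift (p * β) F := by rw [← ht, add_sub_cancel]
    _ = _ := by
      rw [map_add, map_add, ← aeval_mul_apply, ← aeval_mul_apply, ← aeval_mul_apply,
        ← aeval_mul_apply, show α * (p * X ^ n) = p * (α * X ^ n) by ring]
      abel

/-- Dividing `z^N q` by `p`, with `N` the degree of `p`, gives `z^N F = p K + t` with `deg t < N`.
Then `⟨F, g⟩ = ⟨z^N F, z^N g⟩`; the remainder `t` is orthogonal to `z^N H²`, which leaves `⟨K, p♯
g⟩`, bounded by `‖K‖ ‖p g‖`. -/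
theorem mem_range_of_decomposition (hS : IsSelfAdjoint S) (hp : p.Monic) {C : ℝ}
    (hb : ∀ g, ‖aeval shift p g‖ ≤ C * ‖S g‖) (h : hardySpace) (q : ℂ[X]) :
    aeval shift p h + aeval shift q hardyOne ∈ LinearMap.range S.toLinearMap := by
  set N := p.natDegree
  set t := (X ^ N * q) %ₘ p
  set s := (X ^ N * q) /ₘ p
  have hts : t + p * s = X ^ N * q := modByMonic_add_div _ p
  have ht : t.degree < N := by
    rw [← degree_eq_natDegree hp.ne_zero]
    exact degree_modByMonic_lt _ hp
  set K := aeval shift (X ^ N : ℂ[X]) h + aeval shift s hardyOne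
  have hnorm : ∀ g : hardySpace, ‖aeval shift (conjReflect N p) g‖ ≤ 1 * ‖aeval shift p g‖ :=
    norm_aeval_shift_le fun z hz => by rw [norm_eval_conjReflect le_rfl hz, one_mul]
  refine (mem_range_iff_norm_inner_le hS _).2 ⟨‖K‖ * C, fun g => ?_⟩
  set F := aeval shift p h + aeval shift q hardyOne with hF
  have hXF : aeval shift (X ^ N : ℂ[X]) F = aeval shift p K + aeval shift t hardyOne := by
    rw [hF, map_add, map_add, ← aeval_mul_apply, ← aeval_mul_apply, ← aeval_mul_apply,
      ← aeval_mul_apply, ← hts, map_add, add_apply, mul_comm p (X ^ N)]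
    abel
  have h1 := inner_aeval_shift_congr (A := 1) (B := 1) (A' := X ^ N)
    (B' := X ^ N) (fun z hz => by
      simp only [eval_pow, eval_X, eval_one, map_pow, map_one, ← mul_pow,
        conj_mul_self_of_norm_one hz, one_pow, mul_one]) F g
  have h2 := inner_aeval_shift_congr (A := p) (B := X ^ N) (A' := 1)
    (B' := conjReflect N p) (fun z hz => by
      rw [eval_conjReflect le_rfl hz]
      simp only [eval_pow, eval_X, eval_one, map_one, one_mul, N]) K g
  clear_value F
  rw [map_one, one_apply_eq_self, one_apply_eq_self, hXF, inner_add_left, h2,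
    inner_aeval_hardyOne_aeval_X_pow ht, add_zero, map_one, one_apply_eq_self] at h1
  rw [h1, mul_assoc]
  refine (norm_inner_le_norm _ _).trans (mul_le_mul_of_nonneg_left ?_ (norm_nonneg K))
  exact (by simpa using hnorm g : _ ≤ ‖aeval shift p g‖).trans (hb g)

end Characterization

/-- For a rational, non-inner symbol `b` the space `𝓗(b)` is `p H² + ℂ[z]`, where the zeros of the
polynomial `p` lie on the unit circle. -/
theorem exists_mem_deBrangesRovnyak_iff {b : LInfCircle} (hb : IsRationalHInfty b)
    (hb_norm : ‖b‖ = 1) (hb_not_inner : ¬ IsUnimodular b) :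
    ∃ p : ℂ[X], p.Monic ∧ (∀ ζ, p.eval ζ = 0 → ‖ζ‖ = 1) ∧ ∀ F, F ∈ deBrangesRovnyak b ↔
      ∃ (h : hardySpace) (q : ℂ[X]), F = aeval shift p h + aeval shift q hardyOne := by
  obtain ⟨P, Q, hQ0, hb⟩ := hb
  obtain ⟨p, hp, hroots, c, hc, C, hC, hpPQ⟩ :=
    exists_comparable_defect hb_norm hQ0 hb hb_not_inner
  obtain ⟨K, -, hK⟩ := norm_aeval_shift_le_norm_defectOperator hb_norm hQ0 hb hc
    fun z hz => (hpPQ z hz).1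
  have hS := isSelfAdjoint_defectOperator (toeplitz b)
  refine ⟨p, hp, hroots, fun F => ⟨fun hF => ?_, ?_⟩⟩
  · exact exists_decomposition_of_mem_range hS hroots hQ0 (le_max_right P.natDegree Q.natDegree)
      (Real.sqrt_nonneg C) (norm_defectOperator_conjReflect_le hb_norm hQ0 hb
        (le_max_left P.natDegree Q.natDegree) (le_max_right _ _) hC fun z hz => (hpPQ z hz).2) hF
  · rintro ⟨h, q, rfl⟩
    exact mem_range_of_decomposition hS hp hK h q

/-! ### `H²` on the disc: bounded multipliers and radial growth. -/

/-- The Hardy space `H²(𝔻)`, described by square summable Taylor coefficients. The values of `f`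
outside the open unit disc are irrelevant. -/
def MemH2 (f : ℂ → ℂ) : Prop :=
  ∃ c : ℕ → ℂ, Summable (fun n => ‖c n‖ ^ 2) ∧
    ∀ z ∈ Metric.ball (0 : ℂ) 1, HasSum (fun n => c n * z ^ n) (f z)

/-- Bounded analytic functions on the open unit disc. -/
def IsHInfty (ψ : ℂ → ℂ) : Prop :=
  DifferentiableOn ℂ ψ (Metric.ball 0 1) ∧ ∃ C : ℝ, ∀ z ∈ Metric.ball (0 : ℂ) 1, ‖ψ z‖ ≤ C

theorem hasSum_of_forall_eq {f g : ℕ → ℂ} {a : ℂ} (h : ∀ n, f n = g n) (hf : HasSum f a) :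
    HasSum g a := by
  rwa [← funext h]

theorem fourier_natCast_apply (n : ℕ) (t : AddCircle (1 : ℝ)) :
    fourier (n : ℤ) t = fourier 1 t ^ n := by
  rw [fourier_apply, fourier_one, ← Circle.coe_pow, natCast_zsmul, toCircle_nsmul]

/-- Parseval's identity on the circle of radius `r`. -/
theorem exists_L2Circle_dilation {c : ℕ → ℂ} {f : ℂ → ℂ}
    (hf : ∀ z ∈ Metric.ball (0 : ℂ) 1, HasSum (fun n => c n * z ^ n) (f z))
    {r : ℝ} (hr0 : 0 ≤ r) (hr1 : r < 1) :
    ∃ G : L2Circle, (G =ᵐ[haarAddCircle] fun t => f (r * fourier 1 t)) ∧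
      HasSum (fun n => ‖c n‖ ^ 2 * (r ^ n) ^ 2) (‖G‖ ^ 2) := by
  have hsum : Summable fun n : ℕ => (c n * (r : ℂ) ^ n) • fourier (T := (1 : ℝ)) (n : ℤ) := by
    refine Summable.of_norm ?_
    have h1 := (hf r (by simpa [abs_of_nonneg hr0] using hr1)).summable.norm
    simpa only [norm_smul, fourier_norm, mul_one] using h1
  set G₀ := ∑' n : ℕ, (c n * (r : ℂ) ^ n) • fourier (T := (1 : ℝ)) (n : ℤ)
  set G : L2Circle := ContinuousMap.toLp 2 haarAddCircle ℂ G₀ with hG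
  have hval : ∀ t, G₀ t = f (r * fourier 1 t) := fun t => by
    have h1 := ContinuousMap.hasSum_apply hsum.hasSum t
    have h2 := hf (r * fourier 1 t) (by
      rw [mem_ball_zero_iff, norm_mul, norm_fourier_apply, mul_one, Complex.norm_real,
        Real.norm_of_nonneg hr0]
      exact hr1)
    refine h1.unique ?_
    convert h2 using 2 with n
    rw [ContinuousMap.smul_apply, fourier_natCast_apply, smul_eq_mul, mul_pow, mul_assoc]
  have hcoeff : ∀ m : ℤ, fourierCoeff G m =
      if 0 ≤ m then c m.toNat * (r : ℂ) ^ m.toNat else 0 := fun m => by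
    have h1 : HasSum (fun n : ℕ => (c n * (r : ℂ) ^ n) • fourierLp (T := (1 : ℝ)) 2 (n : ℤ)) G := by
      have h2 := (ContinuousMap.toLp (E := ℂ) 2 (haarAddCircle (T := (1 : ℝ))) ℂ).hasSum hsum.hasSum
      simpa only [Function.comp_def, map_smul] using h2
    have h3 := (innerSL ℂ (fourierLp (T := (1 : ℝ)) 2 m)).hasSum h1
    rw [innerSL_apply_apply, ← fourierCoeff_eq_inner] at h3
    simp only [map_smul, innerSL_apply_apply, ← fourierCoeff_eq_inner,
      fourierCoeff_fourierLp, smul_eq_mul, mul_ite, mul_one, mul_zero] at h3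
    refine h3.unique ?_
    split_ifs with hm
    · lift m to ℕ using hm
      refine hasSum_of_forall_eq (fun n => ?_) (hasSum_ite_eq m (c m * (r : ℂ) ^ m))
      by_cases hmn : n = m
      · subst hmn; simp
      · rw [if_neg hmn, if_neg (by lia)]
    · refine hasSum_of_forall_eq (fun n => ?_) (hasSum_zero (α := ℂ) (β := ℕ))
      rw [if_neg (by lia)]
  refine ⟨G, ?_, ?_⟩
  · filter_upwards [ContinuousMap.coeFn_toLp (p := 2) (haarAddCircle (T := (1 : ℝ))) (𝕜 := ℂ) G₀]
      with t ht
    rw [hG, ht, hval]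
  · have h1 := hasSum_sq_fourierCoeff G
    rw [← norm_sq_eq_integral] at h1
    have h2 := (Function.Injective.hasSum_iff (g := ((↑) : ℕ → ℤ)) Nat.cast_injective
      (fun m hm => by
        have hm0 : ¬ 0 ≤ m := fun h0 => hm ⟨m.toNat, Int.toNat_of_nonneg h0⟩
        rw [hcoeff, if_neg hm0, norm_zero]; norm_num)).2 h1
    convert h2 using 2 with n
    simp only [Function.comp_apply, hcoeff, Int.natCast_nonneg, if_true, Int.toNat_natCast,
      norm_mul, norm_pow, Complex.norm_real, Real.norm_of_nonneg hr0, mul_pow]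

theorem MemH2.congr {f g : ℂ → ℂ} (hf : MemH2 f) (h : ∀ z ∈ Metric.ball (0 : ℂ) 1, g z = f z) :
    MemH2 g := by
  obtain ⟨c, hc, hs⟩ := hf
  exact ⟨c, hc, fun z hz => by rw [h z hz]; exact hs z hz⟩

theorem MemH2.add {f g : ℂ → ℂ} (hf : MemH2 f) (hg : MemH2 g) : MemH2 (fun z => f z + g z) := by
  obtain ⟨c, hc, hs⟩ := hf
  obtain ⟨d, hd, ht⟩ := hg
  refine ⟨fun n => c n + d n, ?_, fun z hz => ?_⟩
  · refine Summable.of_nonneg_of_le (fun n => by positivity) (fun n => ?_)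
      ((hc.mul_left 2).add (hd.mul_left 2))
    have h1 := pow_le_pow_left₀ (norm_nonneg _) (norm_add_le (c n) (d n)) 2
    nlinarith [sq_nonneg (‖c n‖ - ‖d n‖)]
  · simpa only [add_mul] using (hs z hz).add (ht z hz)

theorem MemH2.one : MemH2 (fun _ => 1) := by
  refine ⟨fun n => if n = 0 then 1 else 0, ?_, fun z _ => ?_⟩
  · refine summable_of_ne_finset_zero (s := {0}) fun n hn => ?_
    simpa using hn
  · refine hasSum_of_forall_eq (fun n => ?_) (hasSum_ite_eq 0 (1 : ℂ))
    by_cases h : n = 0 <;> simp [h]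

/-- On each circle of radius `r < 1` Parseval turns the pointwise bound on `ψ` into a bound for the
coefficients weighted by `r^(2n)`, uniform in `r`. Letting `r → 1` in finite partial sums removes
the weight. -/
theorem MemH2.mul {ψ f : ℂ → ℂ} (hψ : IsHInfty ψ) (hf : MemH2 f) :
    MemH2 (fun z => ψ z * f z) := by
  obtain ⟨hd, C, hC⟩ := hψ
  obtain ⟨c, hc, hs⟩ := hf
  have hC0 : 0 ≤ C := (norm_nonneg _).trans (hC 0 (by simp))
  set a : ℕ → ℂ := fun n => (n.factorial : ℂ)⁻¹ * iteratedDeriv n ψ 0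
  have ha : ∀ z ∈ Metric.ball (0 : ℂ) 1, HasSum (fun n => a n * z ^ n) (ψ z) := fun z hz => by
    refine hasSum_of_forall_eq (fun n => ?_) (Complex.hasSum_taylorSeries_on_ball hd hz)
    simp only [a, smul_eq_mul, sub_zero]; ring
  set e : ℕ → ℂ := fun n => ∑ kl ∈ Finset.HasAntidiagonal.antidiagonal n, a kl.1 * c kl.2
  have he : ∀ z ∈ Metric.ball (0 : ℂ) 1, HasSum (fun n => e n * z ^ n) (ψ z * f z) := fun z hz => by
    have h1 := (ha z hz).summable.norm
    have h2 := (hs z hz).summable.norm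
    have h3 := tsum_mul_tsum_eq_tsum_sum_antidiagonal_of_summable_norm h1 h2
    have h4 := (summable_norm_sum_mul_antidiagonal_of_summable_norm h1 h2).of_norm.hasSum
    rw [← h3, (ha z hz).tsum_eq, (hs z hz).tsum_eq] at h4
    refine hasSum_of_forall_eq (fun n => ?_) h4
    rw [Finset.sum_mul]
    refine Finset.sum_congr rfl fun kl hkl => ?_
    rw [← Finset.HasAntidiagonal.mem_antidiagonal.1 hkl, pow_add]; ring
  refine ⟨e, ?_, he⟩
  refine summable_of_sum_le (c := C ^ 2 * ∑' n, ‖c n‖ ^ 2) (fun n => by positivity) fun s => ?_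
  have hr : ∀ r : ℝ, r ∈ Set.Ioo (0 : ℝ) 1 →
      ∑ n ∈ s, ‖e n‖ ^ 2 * (r ^ n) ^ 2 ≤ C ^ 2 * ∑' n, ‖c n‖ ^ 2 := fun r ⟨hr0, hr1⟩ => by
    obtain ⟨G, hG, hGs⟩ := exists_L2Circle_dilation he hr0.le hr1
    obtain ⟨K, hK, hKs⟩ := exists_L2Circle_dilation hs hr0.le hr1
    have hle : ‖G‖ ≤ C * ‖K‖ := by
      refine Lp.norm_le_mul_norm_of_ae_le_mul ?_
      filter_upwards [hG, hK] with t h1 h2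
      rw [h1, h2, norm_mul]
      refine mul_le_mul_of_nonneg_right (hC _ ?_) (norm_nonneg _)
      rw [mem_ball_zero_iff, norm_mul, norm_fourier_apply, mul_one, Complex.norm_real,
        Real.norm_of_nonneg hr0.le]
      exact hr1
    calc ∑ n ∈ s, ‖e n‖ ^ 2 * (r ^ n) ^ 2 ≤ ‖G‖ ^ 2 :=
          sum_le_hasSum s (fun n _ => by positivity) hGs
      _ ≤ C ^ 2 * ‖K‖ ^ 2 := by
          rw [← mul_pow]; exact pow_le_pow_left₀ (norm_nonneg _) hle 2
      _ ≤ C ^ 2 * ∑' n, ‖c n‖ ^ 2 := by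
          gcongr
          refine hasSum_le (fun n => ?_) hKs hc.hasSum
          exact mul_le_of_le_one_right (by positivity)
            (pow_le_one₀ (by positivity) (pow_le_one₀ hr0.le hr1.le))
  have hcont : Continuous fun r : ℝ => ∑ n ∈ s, ‖e n‖ ^ 2 * (r ^ n) ^ 2 := by fun_prop
  have ht := (hcont.tendsto 1).mono_left (nhdsWithin_le_nhds (s := Set.Iio 1))
  simp only [one_pow, mul_one] at ht
  exact le_of_tendsto ht (Filter.mem_of_superset (Ioo_mem_nhdsLT zero_lt_one) hr)

theorem IsHInfty.memH2 {ψ : ℂ → ℂ} (hψ : IsHInfty ψ) : MemH2 ψ := by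
  simpa using MemH2.one.mul hψ

theorem isHInfty_eval (P : ℂ[X]) : IsHInfty (fun z => P.eval z) := by
  obtain ⟨C, hC⟩ := (isCompact_closedBall (0 : ℂ) 1).exists_bound_of_continuousOn
    (f := fun z => P.eval z) (by fun_prop)
  exact ⟨P.differentiable.differentiableOn, C, fun z hz => hC z (Metric.ball_subset_closedBall hz)⟩

theorem MemH2.const_mul {f : ℂ → ℂ} (a : ℂ) (hf : MemH2 f) : MemH2 (fun z => a * f z) := by
  simpa using hf.mul (isHInfty_eval (C a))

theorem MemH2.sub {f g : ℂ → ℂ} (hf : MemH2 f) (hg : MemH2 g) : MemH2 (fun z => f z - g z) := by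
  simpa [sub_eq_add_neg] using hf.add (hg.const_mul (-1))

/-- Functions in `H²` are `o((1 - |z|)⁻¹)` along radii. -/
theorem MemH2.tendsto_one_sub_mul_norm {f : ℂ → ℂ} (hf : MemH2 f) {ζ : ℂ} (hζ : ‖ζ‖ = 1) :
    Filter.Tendsto (fun s : ℝ => (1 - s) * ‖f (s * ζ)‖) (nhdsWithin 1 (Set.Iio 1)) (nhds 0) := by
  obtain ⟨c, hc, hs⟩ := hf
  set B := ∑' n, ‖c n‖ ^ 2
  -- From `|cₙ| ≤ ε + |cₙ|²/ε`: the first term sums to `ε/(1 - s)` and the second to at most `B/ε`,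
  -- which the factor `1 - s` kills in the limit.
  have hbound : ∀ ε > 0, ∀ s ∈ Set.Ioo (0 : ℝ) 1,
      (1 - s) * ‖f (s * ζ)‖ ≤ ε + (1 - s) * (B / ε) := fun ε hε s ⟨hs0, hs1⟩ => by
    have hz : ‖(s : ℂ) * ζ‖ = s := by
      rw [norm_mul, hζ, mul_one, Complex.norm_real, Real.norm_of_nonneg hs0.le]
    have h1 : HasSum (fun n => ε * s ^ n + ‖c n‖ ^ 2 / ε) (ε * (1 - s)⁻¹ + B / ε) :=
      ((hasSum_geometric_of_lt_one hs0.le hs1).mul_left ε).add (hc.hasSum.div_const ε)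
    have h2 := tsum_of_norm_bounded (f := fun n => c n * ((s : ℂ) * ζ) ^ n) h1 fun n => by
      rw [norm_mul, norm_pow, hz]
      have hsn0 : 0 ≤ s ^ n := by positivity
      have hsn1 : s ^ n ≤ 1 := pow_le_one₀ hs0.le hs1.le
      have h3 : ‖c n‖ ≤ ε + ‖c n‖ ^ 2 / ε := by
        rw [← sub_le_iff_le_add', le_div_iff₀ hε]
        nlinarith [sq_nonneg (‖c n‖ - ε), norm_nonneg (c n), sq_nonneg ε]
      have h4 : 0 ≤ ‖c n‖ ^ 2 / ε := by positivity
      nlinarith [mul_le_mul_of_nonneg_right h3 hsn0, mul_le_of_le_one_right h4 hsn1]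
    rw [(hs _ (by rw [mem_ball_zero_iff, hz]; exact hs1)).tsum_eq] at h2
    have h5 : 0 < 1 - s := by linarith
    calc (1 - s) * ‖f (s * ζ)‖ ≤ (1 - s) * (ε * (1 - s)⁻¹ + B / ε) := by gcongr
      _ = _ := by field_simp
  rw [Metric.tendsto_nhds]
  intro δ hδ
  have hcont : Continuous fun s : ℝ => δ / 2 + (1 - s) * (B / (δ / 2)) := by fun_prop
  have ht : ∀ᶠ s in nhdsWithin (1 : ℝ) (Set.Iio 1), δ / 2 + (1 - s) * (B / (δ / 2)) < δ :=
    ((hcont.tendsto 1).mono_left nhdsWithin_le_nhds).eventually_lt_const (by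
      simp only [sub_self, zero_mul, add_zero]; linarith)
  filter_upwards [ht, Ioo_mem_nhdsLT (zero_lt_one (α := ℝ))] with s h1 h2
  rw [Real.dist_eq, sub_zero, abs_of_nonneg (mul_nonneg (by linarith [h2.2]) (norm_nonneg _))]
  exact (hbound (δ / 2) (by positivity) s h2).trans_lt h1

/-- On the radius to `ζ` one has `|z - ζ| = 1 - s`, so the left side tends to zero by the radial
growth bound, while `r` is continuous. -/
theorem eval_eq_zero_of_mul_eq {d r : ℂ[X]} {e : ℂ → ℂ} (he : MemH2 e) {ζ : ℂ} (hζ : ‖ζ‖ = 1)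
    (h : ∀ z ∈ Metric.ball (0 : ℂ) 1, ((X - C ζ) * d).eval z * e z = r.eval z) :
    r.eval ζ = 0 := by
  have h1 : Filter.Tendsto (fun s : ℝ => ‖r.eval (s * ζ)‖) (nhdsWithin 1 (Set.Iio 1))
      (nhds ‖r.eval ζ‖) := by
    have hcont : Continuous fun s : ℝ => ‖r.eval (s * ζ)‖ := by fun_prop
    simpa using (hcont.tendsto 1).mono_left (nhdsWithin_le_nhds (s := Set.Iio 1))
  have h2 : Filter.Tendsto (fun s : ℝ => ‖d.eval (s * ζ)‖ * ((1 - s) * ‖e (s * ζ)‖))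
      (nhdsWithin 1 (Set.Iio 1)) (nhds 0) := by
    have hcont : Continuous fun s : ℝ => ‖d.eval (s * ζ)‖ := by fun_prop
    simpa using ((hcont.tendsto 1).mono_left (nhdsWithin_le_nhds (s := Set.Iio 1))).mul
      (he.tendsto_one_sub_mul_norm hζ)
  have h3 : (fun s : ℝ => ‖r.eval (s * ζ)‖) =ᶠ[nhdsWithin 1 (Set.Iio 1)]
      fun s : ℝ => ‖d.eval (s * ζ)‖ * ((1 - s) * ‖e (s * ζ)‖) := by
    filter_upwards [Ioo_mem_nhdsLT (zero_lt_one (α := ℝ))] with s hs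
    have hz : ‖(s : ℂ) * ζ‖ = s := by
      rw [norm_mul, hζ, mul_one, Complex.norm_real, Real.norm_of_nonneg hs.1.le]
    have h4 : ‖(s : ℂ) * ζ - ζ‖ = 1 - s := by
      rw [← sub_one_mul, norm_mul, hζ, mul_one, ← Complex.ofReal_one, ← Complex.ofReal_sub,
        Complex.norm_real, Real.norm_eq_abs, abs_sub_comm, abs_of_pos (by linarith [hs.2])]
    rw [← h _ (by rw [mem_ball_zero_iff, hz]; exact hs.2), eval_mul, eval_sub, eval_X, eval_C,
      norm_mul, norm_mul, h4]
    ring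
  exact norm_eq_zero.1 (tendsto_nhds_unique h1 (h2.congr' h3.symm))

/-- A polynomial in `d H²`, where the zeros of `d` lie on the unit circle, is divisible by `d`. -/
theorem dvd_of_mul_memH2_eq {d r : ℂ[X]} (hd : ∀ ζ, d.eval ζ = 0 → ‖ζ‖ = 1) {e : ℂ → ℂ}
    (he : MemH2 e) (h : ∀ z ∈ Metric.ball (0 : ℂ) 1, d.eval z * e z = r.eval z) : d ∣ r := by
  induction hn : d.natDegree generalizing d r with
  | zero =>
    rw [eq_C_of_natDegree_eq_zero hn] at hd ⊢
    refine (isUnit_C.2 (isUnit_iff_ne_zero.2 fun h0 => ?_)).dvd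
    simpa using hd 0 (by rw [h0]; simp)
  | succ n ih =>
    obtain ⟨ζ, hζ⟩ := IsAlgClosed.exists_root d
      (fun h0 => by
        rw [natDegree_eq_of_degree_eq_some (n := 0) h0] at hn; lia)
    have hζ1 := hd ζ hζ
    obtain ⟨d, rfl⟩ := dvd_iff_isRoot.2 hζ
    obtain ⟨r, rfl⟩ := dvd_iff_isRoot.2 (eval_eq_zero_of_mul_eq he hζ1 h)
    refine mul_dvd_mul_left _ (ih (fun w hw => hd w (by simp [hw])) (fun z hz => ?_) ?_)
    · have hne : z - ζ ≠ 0 := sub_ne_zero.2 fun h0 => by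
        rw [h0, mem_ball_zero_iff, hζ1] at hz
        exact lt_irrefl _ hz
      have h1 := h z hz
      rw [eval_mul, eval_mul, eval_sub, eval_X, eval_C, mul_assoc] at h1
      exact mul_left_cancel₀ hne h1
    · have hd0 : d ≠ 0 := by rintro rfl; simp at hn
      rw [natDegree_mul (X_sub_C_ne_zero ζ) hd0, natDegree_X_sub_C] at hn
      lia

/-! ### Passage between boundary functions and functions on the disc. -/

theorem summable_sq_fourierCoeff_natCast (F : L2Circle) :
    Summable fun n : ℕ => ‖fourierCoeff F (n : ℤ)‖ ^ 2 :=
  (hasSum_sq_fourierCoeff F).summable.comp_injective Nat.cast_injective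

/-- Functions in `H²` have an analytic extension to the disc. -/
theorem exists_memH2_of_hardySpace (F : hardySpace) :
    ∃ f, MemH2 f ∧ ∀ z ∈ Metric.ball (0 : ℂ) 1,
      HasSum (fun n : ℕ => fourierCoeff (F : L2Circle) (n : ℤ) * z ^ n) (f z) := by
  have hsq := summable_sq_fourierCoeff_natCast F
  have hs : ∀ z ∈ Metric.ball (0 : ℂ) 1,
      HasSum (fun n : ℕ => fourierCoeff (F : L2Circle) (n : ℤ) * z ^ n)
        (∑' n : ℕ, fourierCoeff (F : L2Circle) (n : ℤ) * z ^ n) := fun z hz => by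
    rw [mem_ball_zero_iff] at hz
    have hz2 : ‖z‖ ^ 2 < 1 := by nlinarith [norm_nonneg z]
    refine Summable.hasSum (Summable.of_norm_bounded
      (hsq.add (summable_geometric_of_lt_one (by positivity) hz2)) fun n => ?_)
    rw [norm_mul, norm_pow, ← pow_mul, mul_comm 2, pow_mul]
    nlinarith [sq_nonneg (‖fourierCoeff (F : L2Circle) (n : ℤ)‖ - ‖z‖ ^ n),
      sq_nonneg ‖fourierCoeff (F : L2Circle) (n : ℤ)‖, sq_nonneg (‖z‖ ^ n)]
  exact ⟨_, ⟨_, hsq, hs⟩, hs⟩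

theorem MemH2.exists_hardySpace {f : ℂ → ℂ} (hf : MemH2 f) :
    ∃ F : hardySpace, ∀ z ∈ Metric.ball (0 : ℂ) 1,
      HasSum (fun n : ℕ => fourierCoeff (F : L2Circle) (n : ℤ) * z ^ n) (f z) := by
  obtain ⟨c, hc, hs⟩ := hf
  set a : ℤ → ℂ := fun n => if 0 ≤ n then c n.toNat else 0
  have ha : Memℓp a 2 := by
    refine memℓp_gen ?_
    refine (Function.Injective.summable_iff (g := ((↑) : ℕ → ℤ)) Nat.cast_injective
      fun m hm => ?_).1 ?_
    · have hm0 : ¬ 0 ≤ m := fun h0 => hm ⟨m.toNat, Int.toNat_of_nonneg h0⟩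
      simp [a, hm0]
    · simpa [a, Function.comp_def] using hc
  set F : L2Circle := (fourierBasis (T := (1 : ℝ))).repr.symm ⟨a, ha⟩
  have hF : ∀ n, fourierCoeff F n = a n := fun n => by
    rw [← fourierBasis_repr, LinearIsometryEquiv.apply_symm_apply]
  refine ⟨⟨F, fun n hn => by rw [hF]; exact if_neg (by lia)⟩, fun z hz => ?_⟩
  refine hasSum_of_forall_eq (fun n => ?_) (hs z hz)
  simp [hF, a]

theorem hasSum_fourierCoeff_aeval_shift (P : ℂ[X]) (F : hardySpace) {z w : ℂ}
    (h : HasSum (fun n : ℕ => fourierCoeff (F : L2Circle) (n : ℤ) * z ^ n) w) :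
    HasSum (fun n : ℕ => fourierCoeff (aeval shift P F : L2Circle) (n : ℤ) * z ^ n)
      (P.eval z * w) := by
  induction P using Polynomial.induction_on generalizing F w with
  | C a =>
    rw [eval_C]
    refine hasSum_of_forall_eq (fun n => ?_) (h.mul_left a)
    rw [aeval_C, Algebra.algebraMap_eq_smul_one, ← mul_assoc]
    exact congrArg (· * z ^ n) (fourierCoeff_coe_smul a (F : L2Circle) n).symm
  | add P Q hP hQ =>
    rw [eval_add, add_mul]
    refine hasSum_of_forall_eq (fun n => ?_) ((hP F h).add (hQ F h))
    rw [map_add, ← add_mul]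
    exact congrArg (· * z ^ n) (fourierCoeff_coe_add _ _ n).symm
  | monomial n a ih =>
    rw [pow_succ, ← mul_assoc, eval_mul (q := X), eval_X, aeval_mul_apply, aeval_X, mul_assoc]
    refine ih (shift F) ?_
    refine (hasSum_nat_add_iff' 1).1 (hasSum_of_forall_eq
      (f := fun n : ℕ => z * (fourierCoeff (F : L2Circle) (n : ℤ) * z ^ n)) (fun n => ?_) ?_ :
      HasSum (fun n : ℕ => fourierCoeff (shift F : L2Circle) ((n + 1 : ℕ) : ℤ) * z ^ (n + 1)) _)
    · rw [fourierCoeff_shift]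
      push_cast
      rw [add_sub_cancel_right]
      ring
    · have h0 : fourierCoeff (shift F : L2Circle) 0 = 0 := by
        rw [fourierCoeff_shift]
        exact F.2 _ (by norm_num)
      simpa [h0] using h.mul_left z

theorem hasSum_fourierCoeff_hardyOne (z : ℂ) :
    HasSum (fun n : ℕ => fourierCoeff (hardyOne : L2Circle) (n : ℤ) * z ^ n) 1 := by
  refine hasSum_of_forall_eq (fun n => ?_) (hasSum_ite_eq 0 (1 : ℂ))
  rw [fourierCoeff_hardyOne]
  by_cases h : n = 0 <;> simp [h]

/-! ### Multiplication and division inside `p H² + ℂ[z]`. -/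

/-- The space `p H² + ℂ[z]` of analytic functions on the disc. -/
def MemAddPoly (p : ℂ[X]) (f : ℂ → ℂ) : Prop :=
  ∃ (h : ℂ → ℂ) (q : ℂ[X]), MemH2 h ∧
    ∀ z ∈ Metric.ball (0 : ℂ) 1, f z = p.eval z * h z + q.eval z

theorem exists_memHb_iff {b : LInfCircle} (hb : IsRationalHInfty b)
    (hb_norm : ‖b‖ = 1) (hb_not_inner : ¬ IsUnimodular b) :
    ∃ p : ℂ[X], p.Monic ∧ (∀ ζ, p.eval ζ = 0 → ‖ζ‖ = 1) ∧
      ∀ f, MemHb b f ↔ MemAddPoly p f := by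
  obtain ⟨p, hp, hroots, hiff⟩ := exists_mem_deBrangesRovnyak_iff hb hb_norm hb_not_inner
  have hsum : ∀ (H : hardySpace) (q : ℂ[X]) {z w : ℂ},
      HasSum (fun n : ℕ => fourierCoeff (H : L2Circle) (n : ℤ) * z ^ n) w →
      HasSum (fun n : ℕ => fourierCoeff
        ((aeval shift p H + aeval shift q hardyOne : hardySpace) : L2Circle) (n : ℤ) * z ^ n)
        (p.eval z * w + q.eval z) := fun H q z w h => by
    have h1 := (hasSum_fourierCoeff_aeval_shift p H h).add
      (hasSum_fourierCoeff_aeval_shift q hardyOne (hasSum_fourierCoeff_hardyOne z))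
    rw [mul_one] at h1
    refine hasSum_of_forall_eq (fun n => ?_) h1
    rw [← add_mul]
    exact congrArg (· * z ^ n) (fourierCoeff_coe_add _ _ n).symm
  refine ⟨p, hp, hroots, fun f => ⟨?_, ?_⟩⟩
  · rintro ⟨F, hF, hf⟩
    obtain ⟨H, q, rfl⟩ := (hiff F).1 hF
    obtain ⟨h, hh, hH⟩ := exists_memH2_of_hardySpace H
    exact ⟨h, q, hh, fun z hz => (hf z hz).unique (hsum H q (hH z hz))⟩
  · rintro ⟨h, q, hh, hf⟩
    obtain ⟨H, hH⟩ := hh.exists_hardySpace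
    exact ⟨_, (hiff _).2 ⟨H, q, rfl⟩, fun z hz => by
      rw [hf z hz]; exact hsum H q (hH z hz)⟩

section MemAddPoly

variable {p : ℂ[X]} {f g u v φ ψ : ℂ → ℂ}

theorem MemAddPoly.congr (hf : MemAddPoly p f) (h : ∀ z ∈ Metric.ball (0 : ℂ) 1, g z = f z) :
    MemAddPoly p g := by
  obtain ⟨e, q, he, hs⟩ := hf
  exact ⟨e, q, he, fun z hz => by rw [h z hz, hs z hz]⟩

theorem MemAddPoly.add (hf : MemAddPoly p f) (hg : MemAddPoly p g) :
    MemAddPoly p fun z => f z + g z := by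
  obtain ⟨e, q, he, hs⟩ := hf
  obtain ⟨e', q', he', hs'⟩ := hg
  refine ⟨_, q + q', he.add he', fun z hz => ?_⟩
  simp only [hs z hz, hs' z hz, eval_add]
  ring

theorem MemAddPoly.const_mul (a : ℂ) (hf : MemAddPoly p f) : MemAddPoly p fun z => a * f z := by
  obtain ⟨e, q, he, hs⟩ := hf
  refine ⟨_, C a * q, he.const_mul a, fun z hz => ?_⟩
  simp only [hs z hz, eval_mul, eval_C]
  ring

/-- If the zeros of `p` lie on the circle, then multiplying twice by a bounded analytic function
stays in `p H² + ℂ[z]` as soon as multiplying once does. -/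
theorem MemAddPoly.mul_mul (hp : ∀ ζ, p.eval ζ = 0 → ‖ζ‖ = 1)
    (hψ : IsHInfty ψ) (hu : MemAddPoly p u) (hv : MemAddPoly p fun z => u z * ψ z) :
    MemAddPoly p fun z => u z * ψ z * ψ z := by
  obtain ⟨g, q, hg, hu⟩ := hu
  obtain ⟨h, r, hh, hv⟩ := hv
  have hh' : MemH2 fun z => h z - ψ z * g z := hh.sub (hg.mul hψ)
  -- Comparing the two representations of `uψ` isolates `qψ`, which is thus again in `p H² + ℂ[z]`.
  have hqψ : ∀ z ∈ Metric.ball (0 : ℂ) 1,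
      q.eval z * ψ z = p.eval z * (h z - ψ z * g z) + r.eval z := fun z hz => by
    linear_combination hv z hz - ψ z * hu z hz
  set d := EuclideanDomain.gcd p q
  obtain ⟨p₁, hp₁⟩ : d ∣ p := EuclideanDomain.gcd_dvd_left p q
  obtain ⟨q₁, hq₁⟩ : d ∣ q := EuclideanDomain.gcd_dvd_right p q
  -- Solving for `r` exhibits it as `d` times an `H²` function, and the zeros of `d`, being zeros of
  -- `p`, lie on the circle.
  obtain ⟨r₁, rfl⟩ : d ∣ r := by
    refine dvd_of_mul_memH2_eq (e := fun z => q₁.eval z * ψ z - p₁.eval z * (h z - ψ z * g z))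
      (fun ζ hζ => hp ζ (by rw [hp₁, eval_mul, hζ, zero_mul]))
      ((hψ.memH2.mul (isHInfty_eval q₁)).sub (hh'.mul (isHInfty_eval p₁))) fun z hz => ?_
    have h1 := hqψ z hz
    rw [hp₁, hq₁, eval_mul, eval_mul] at h1
    linear_combination h1
  have hbez : d = p * EuclideanDomain.gcdA p q + q * EuclideanDomain.gcdB p q :=
    EuclideanDomain.gcd_eq_gcd_ab p q
  set s := EuclideanDomain.gcdB p q * r₁
  set t := EuclideanDomain.gcdA p q * r₁
  have hr : d * r₁ = q * s + p * t := by
    simp only [s, t]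
    linear_combination r₁ * hbez
  -- Here `uψ² = pψh + rψ`, and `r = qs + pt` gives `rψ = s(qψ) + ptψ`; inserting the formula for
  -- `qψ` leaves the polynomial part `s r`.
  refine ⟨fun z => ψ z * h z + s.eval z * (h z - ψ z * g z) + t.eval z * ψ z, s * (d * r₁),
    ((hh.mul hψ).add (hh'.mul (isHInfty_eval s))).add (hψ.memH2.mul (isHInfty_eval t)),
    fun z hz => ?_⟩
  have hrz : (d * r₁).eval z = q.eval z * s.eval z + p.eval z * t.eval z := by
    rw [hr, eval_add, eval_mul (p := q), eval_mul (p := p)]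
  rw [eval_mul (p := s)]
  linear_combination ψ z * hv z hz + s.eval z * hqψ z hz + ψ z * hrz

theorem MemAddPoly.mul_eval (hp : ∀ ζ, p.eval ζ = 0 → ‖ζ‖ = 1)
    (hφ : IsHInfty φ) (P : ℂ[X]) (hu : MemAddPoly p u) (hv : MemAddPoly p fun z => u z * φ z) :
    MemAddPoly p fun z => u z * P.eval (φ z) := by
  induction P using Polynomial.induction_on generalizing u with
  | C a => exact (hu.const_mul a).congr fun z _ => by rw [eval_C, mul_comm]
  | add P Q hP hQ => exact ((hP hu hv).add (hQ hu hv)).congr fun z _ => by rw [eval_add, mul_add]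
  | monomial n a ih =>
    -- The induction hypothesis is applied to `uφ` in place of `u`; its second requirement, on
    -- `uφ²`, is the squaring lemma.
    refine (ih hv (hu.mul_mul hp hφ hv)).congr fun z _ => ?_
    simp only [eval_mul, eval_pow, eval_X, eval_C, pow_succ]
    ring

theorem one_sub_norm_le_norm_one_sub {l w : ℂ} (hw : ‖w‖ ≤ 1) :
    1 - ‖l‖ ≤ ‖1 - (starRingEnd ℂ) l * w‖ := by
  have h1 : ‖(starRingEnd ℂ) l * w‖ ≤ ‖l‖ := by
    rw [norm_mul, RCLike.norm_conj]
    exact mul_le_of_le_one_right (norm_nonneg _) hw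
  have h2 := norm_sub_norm_le (1 : ℂ) ((starRingEnd ℂ) l * w)
  rw [norm_one] at h2
  linarith

theorem one_sub_conj_mul_ne_zero {l w : ℂ} (hl : ‖l‖ < 1) (hw : ‖w‖ ≤ 1) :
    1 - (starRingEnd ℂ) l * w ≠ 0 :=
  norm_pos_iff.1 ((sub_pos.2 hl).trans_le (one_sub_norm_le_norm_one_sub hw))

theorem isHInfty_inv_one_sub {l : ℂ} (hl : ‖l‖ < 1)
    (hφ : DifferentiableOn ℂ φ (Metric.ball 0 1))
    (hφ1 : ∀ z ∈ Metric.ball (0 : ℂ) 1, ‖φ z‖ ≤ 1) :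
    IsHInfty fun z => (1 - (starRingEnd ℂ) l * φ z)⁻¹ := by
  refine ⟨((hφ.const_mul _).const_sub 1).inv fun z hz => one_sub_conj_mul_ne_zero hl (hφ1 z hz),
    (1 - ‖l‖)⁻¹, fun z hz => ?_⟩
  rw [norm_inv]
  exact inv_anti₀ (sub_pos.2 hl) (one_sub_norm_le_norm_one_sub (hφ1 z hz))

/-- With `ψ = (1 - conj l · φ)⁻¹` and `w = u (1 - conj l · φ)`, both `w` and `wψ = u` are in the
space, so `wψ² = uψ` is too. -/
theorem MemAddPoly.div_one_sub (hp : ∀ ζ, p.eval ζ = 0 → ‖ζ‖ = 1) {l : ℂ} (hl : ‖l‖ < 1)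
    (hφ : DifferentiableOn ℂ φ (Metric.ball 0 1))
    (hφ1 : ∀ z ∈ Metric.ball (0 : ℂ) 1, ‖φ z‖ ≤ 1)
    (hu : MemAddPoly p u) (hv : MemAddPoly p fun z => u z * φ z) :
    MemAddPoly p fun z => u z / (1 - (starRingEnd ℂ) l * φ z) := by
  have hψ := isHInfty_inv_one_sub hl hφ hφ1
  have h1 := hu.add (hv.const_mul (-(starRingEnd ℂ) l))
  have hne := fun z hz => one_sub_conj_mul_ne_zero hl (hφ1 z hz)
  refine (h1.mul_mul hp hψ (hu.congr fun z hz => ?_)).congr fun z hz => ?_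
  all_goals
    have := hne z hz
    field_simp
    ring

/-- The functions `u` such that both `u` and `u φ` belong to `p H² + ℂ[z]` are stable under
division by powers of `1 - conj λ · φ`. -/
theorem MemAddPoly.div_prod (hp : ∀ ζ, p.eval ζ = 0 → ‖ζ‖ = 1)
    (hφ : DifferentiableOn ℂ φ (Metric.ball 0 1))
    (hφ1 : ∀ z ∈ Metric.ball (0 : ℂ) 1, ‖φ z‖ ≤ 1)
    (hu : MemAddPoly p u) (hv : MemAddPoly p fun z => u z * φ z)
    {ι : Type*} (s : Finset ι) (l : ι → ℂ) (m : ι → ℕ) (hl : ∀ j, ‖l j‖ < 1) :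
    MemAddPoly p (fun z => u z / ∏ j ∈ s, (1 - (starRingEnd ℂ) (l j) * φ z) ^ m j) ∧
    MemAddPoly p (fun z => u z / (∏ j ∈ s, (1 - (starRingEnd ℂ) (l j) * φ z) ^ m j) * φ z) := by
  have hφ' : IsHInfty φ := ⟨hφ, 1, hφ1⟩
  -- The pair `w`, `wφ` is carried along together, since each further division needs the product
  -- with `φ` as well.
  have hpow : ∀ (a : ℂ), ‖a‖ < 1 → ∀ (n : ℕ) (w : ℂ → ℂ), MemAddPoly p w →
      (MemAddPoly p fun z => w z * φ z) →
      MemAddPoly p (fun z => w z / (1 - (starRingEnd ℂ) a * φ z) ^ n) ∧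
      MemAddPoly p (fun z => w z / (1 - (starRingEnd ℂ) a * φ z) ^ n * φ z) := by
    intro a ha n w hw hwφ
    induction n with
    | zero => simpa using ⟨hw, hwφ⟩
    | succ n ih =>
      have h1 := ih.1.div_one_sub hp ha hφ hφ1 ih.2
      have h2 := ih.2.div_one_sub hp ha hφ hφ1 (ih.1.mul_mul hp hφ' ih.2)
      refine ⟨h1.congr fun z _ => ?_, h2.congr fun z _ => ?_⟩
      · rw [pow_succ, div_div]
      · rw [pow_succ, ← div_div, div_mul_eq_mul_div]
  classical
  induction s using Finset.induction_on with
  | empty => simpa using ⟨hu, hv⟩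
  | insert j s hj ih =>
    have h1 := hpow (l j) (hl j) (m j) _ ih.1 ih.2
    refine ⟨h1.1.congr fun z _ => ?_, h1.2.congr fun z _ => ?_⟩ <;>
      rw [Finset.prod_insert hj, mul_comm (_ ^ _), div_div]

end MemAddPoly

end

end DeBrangesRovnyak

theorem theorem3p1
    (b : DeBrangesRovnyak.LInfCircle)
    (hb : DeBrangesRovnyak.IsRationalHInfty b)
    (hb_norm : ‖b‖ = 1)
    (hb_not_inner : ¬ DeBrangesRovnyak.IsUnimodular b)
    (u φ : ℂ → ℂ)
    (hφ : DifferentiableOn ℂ φ (Metric.ball 0 1))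
    (hφ_maps : Set.MapsTo φ (Metric.ball 0 1) (Metric.ball 0 1))
    (H1 : DeBrangesRovnyak.MemHb b u)
    (H2 : DeBrangesRovnyak.MemHb b (fun z => u z * φ z)) :
    (∀ p : ℂ[X], DeBrangesRovnyak.MemHb b (fun z => u z * p.eval (φ z))) ∧
    (∀ (p : ℂ[X]) (k : ℕ) (l : Fin k → ℂ) (m : Fin k → ℕ),
      (∀ j, l j ∈ Metric.ball (0 : ℂ) 1) →
      DeBrangesRovnyak.MemHb b (fun z => u z * p.eval (φ z) /
        ∏ j, (1 - (starRingEnd ℂ) (l j) * φ z) ^ m j)) := by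
  obtain ⟨p, -, hroots, hiff⟩ := DeBrangesRovnyak.exists_memHb_iff hb hb_norm hb_not_inner
  rw [hiff] at H1 H2
  have hφ1 : ∀ z ∈ Metric.ball (0 : ℂ) 1, ‖φ z‖ ≤ 1 := fun z hz =>
    (mem_ball_zero_iff.1 (hφ_maps hz)).le
  have hφ' : DeBrangesRovnyak.IsHInfty φ := ⟨hφ, 1, hφ1⟩
  refine ⟨fun P => (hiff _).2 (H1.mul_eval hroots hφ' P H2), fun P k l m hl => (hiff _).2 ?_⟩
  have h1 := H1.mul_eval hroots hφ' P H2
  -- Division also requires the numerator times `φ`, which is the polynomial case for `P * X`.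
  have h2 := (H1.mul_eval hroots hφ' (P * X) H2).congr
    (g := fun z => u z * P.eval (φ z) * φ z) fun z _ => by rw [eval_mul, eval_X, mul_assoc]
  exact (h1.div_prod hroots hφ hφ1 h2 Finset.univ l m
    fun j => mem_ball_zero_iff.1 (hl j)).1
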